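/- Let $C,u>0$, $\theta\in(0,1)$, $s>2$ be constants, let $(\Omega,\mathbb P)$ be a probability space with expectation $\mathbb E$, and let $(\xi_l)_{l\ge 0}$ be a sequence of real square-integrable random variables. Write $\hat X=X-\mathbb E(X)$. Assume: (H1) for every real $K\ge 1$ there are random variables $\xi_l^K$ ($l\ge0$) with $|\xi_l^K|\le K$ almost surely, $\mathbb E|\xi_l^K-\xi_l|\le CK^{1-s}$ and $\mathbb E\big((\xi_l^K-\xi_l)^2\big)\le CK^{2-s}$; (H2) for each $n$ there is a filtration $(\mathcal F_l)_{0\le l<n}=(\mathcal F_{l,n})_{0\le l<n}$ such that for all $K\ge1$ and all $l,k\ge 0$ with $l+k<n$ there is an $\mathcal F_{l+k}$-measurable random variable $\xi^K_{l,l+k}$ with $|\xi^K_{l,l+k}|\le K$ almost surely, $\mathbb E\,\xi^K_{l,l+k}=\mathbb E\,\xi_l^K$ and $$\mathbb P\big(|\xi_l^K-\xi_{l,l+k}^K|\ge\theta^k\big)\le CK^u(l+1)^u\theta^k;$$ (H3) for each $n$, all $K\ge 1$ and all $l,k\ge0$ with $l+k<n$ there is an event $G_{l,k}$ (which may depend on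 $n$ and $K$) with $\mathbb P(G_{l,k}^c)\le C\theta^k$ such that, for almost every $\omega\in G_{l,k}$, $$|\mathbb E(\hat\xi_{l+k}^K\mid\mathcal F_l)(\omega)|\le C(l+1)^uK^u\theta^k;$$ (H4) there are real numbers $b_{K,j}$ ($K\ge1$, $j\ge0$), not depending on $n$, such that for each $n$, all $K\ge1$, all $l\ge0$ and $k'\ge k\ge0$ with $l+k'<n$, and almost every $\omega\in G_{l,k}$, $$\big|\mathbb E(\hat\xi_{l+k}^K\hat\xi_{l+k'}^K\mid\mathcal F_l)(\omega)-b_{K,k'-k}\big|\le C(l+1)^uK^ue^{u(k'-k)}\theta^k .$$ Then the limits $\sigma_j=\lim_{K\to\infty}b_{K,j}$ exist for all $j\ge0$, the series $\sum_j\sigma_j$ converges absolutely, and $\sigma^2:=\sigma_0+2\sum_{j\ge1}\sigma_j\ge0$. Suppose moreover that $\sigma^2>0$, and let $\sigma>0$ be its square root. Then the following hold. (a) If $\omega$ is distributed according to $\mathbb P$, then, as $n\to\infty$, $$\frac{\sum_{l=0}^{n-1}\hat\xi_l}{\sigma\sqrt n}\Longrightarrow\mathcal N(0,1).$$ (b)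 Let $\varepsilon>0$ satisfy $\frac{1+\varepsilon}{s}+\varepsilon<\frac12$ and put $K_n=n^{(1+\varepsilon)/s}$. For each $n$ let $\mathbb P_n$ be a probability measure, with expectation $\mathbb E_n$, which has a density $\rho_n\ge 0$ with respect to $\mathbb P$. Assume that for all $n\ge1$: (D1) $\rho_n\le Cn^u$ almost surely; (D2) for each $0\le k<n$ there is an $\mathcal F_{k,n}$-measurable function $\rho_{n,k}$ (for instance a density) with $\mathbb P(|\rho_n-\rho_{n,k}|\ge\theta^k)\le Cn^u\theta^k$; (D3) for each integer $l$ with $n^\varepsilon\le l\le n$, $\mathbb E_n\big(|\xi_l-\xi_l^{K_n}|\big)\le CK_n^{1-s}$. Then, if $\omega$ is distributed according to $\mathbb P_n$, as $n\to\infty$, $$\frac{\sum_{n^\varepsilon\le l\le n-1}\hat\xi_l}{\sigma\sqrt n}\Longrightarrow\mathcal N(0,1),$$ where the centring $\hat\xi_l=\xi_l-\mathbb E(\xi_l)$ is still with respect to $\mathbb P$. -/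

import Mathlib

open MeasureTheory ProbabilityTheory Filter Topology

namespace WeakDepCLT

variable {Ω : Type*} {mΩ : MeasurableSpace Ω}

/-- The centred random variable `X - E(X)`, the expectation being taken with respect to `P`. -/
noncomputable def centered (P : Measure Ω) (X : Ω → ℝ) : Ω → ℝ :=
  fun ω => X ω - ∫ ω', X ω' ∂P

/-- (H1): the `ξ l` are square integrable and, for every level `K ≥ 1`, the random variables
`ξK K l` are bounded by `K` almost surely and approximate the `ξ l` in `L¹` and in `L²`, with errors
`O(K^(1-s))` and `O(K^(2-s))` which are uniform in `l`. -/
structure Truncation (P : Measure Ω) (C s : ℝ) (ξ : ℕ → Ω → ℝ) (ξK : ℝ → ℕ → Ω → ℝ) : Prop where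
  memLp : ∀ l, MemLp (ξ l) 2 P
  measurable : ∀ K : ℝ, 1 ≤ K → ∀ l, Measurable (ξK K l)
  bounded : ∀ K : ℝ, 1 ≤ K → ∀ l, ∀ᵐ ω ∂P, |ξK K l ω| ≤ K
  l1_error : ∀ K : ℝ, 1 ≤ K → ∀ l, ∫ ω, |ξK K l ω - ξ l ω| ∂P ≤ C * K ^ (1 - s)
  l2_error : ∀ K : ℝ, 1 ≤ K → ∀ l, ∫ ω, (ξK K l ω - ξ l ω) ^ 2 ∂P ≤ C * K ^ (2 - s)

/-- (H2): `ξK K l` is well approximated by a variable `η` (written `ξ_{l,l+k}^K`) which is measurable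
with respect to the `(l+k)`-th σ-algebra of the `n`-th filtration. Only the σ-algebras `F n l` with
`l < n` are used. -/
def AdaptedApprox (P : Measure Ω) (C u θ : ℝ) (ξK : ℝ → ℕ → Ω → ℝ)
    (F : ℕ → Filtration ℕ mΩ) : Prop :=
  ∀ K : ℝ, 1 ≤ K → ∀ n l k : ℕ, l + k < n →
    ∃ η : Ω → ℝ, Measurable[F n (l + k)] η ∧ (∀ᵐ ω ∂P, |η ω| ≤ K) ∧
      ∫ ω, η ω ∂P = ∫ ω, ξK K l ω ∂P ∧
      P.real {ω | θ ^ k ≤ |ξK K l ω - η ω|} ≤ C * K ^ u * ((l : ℝ) + 1) ^ u * θ ^ k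

/-- The good events `G n K l k` (written `G_{l,k}`) on which the conditional estimates hold:
their complements have exponentially small probability. -/
def GoodEvents (P : Measure Ω) (C θ : ℝ) (G : ℕ → ℝ → ℕ → ℕ → Set Ω) : Prop :=
  ∀ K : ℝ, 1 ≤ K → ∀ n l k : ℕ, l + k < n →
    MeasurableSet (G n K l k) ∧ P.real (G n K l k)ᶜ ≤ C * θ ^ k

/-- (H3): exponential decay of the conditional means on the good events. -/
def CondMeanDecay (P : Measure Ω) (C u θ : ℝ) (ξK : ℝ → ℕ → Ω → ℝ)
    (F : ℕ → Filtration ℕ mΩ) (G : ℕ → ℝ → ℕ → ℕ → Set Ω) : Prop :=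
  ∀ K : ℝ, 1 ≤ K → ∀ n l k : ℕ, l + k < n →
    ∀ᵐ ω ∂P, ω ∈ G n K l k →
      |(P[centered P (ξK K (l + k)) | F n l]) ω| ≤ C * ((l : ℝ) + 1) ^ u * K ^ u * θ ^ k

/-- (H4): exponential convergence of the conditional covariances, on the good events, to the
deterministic numbers `b K (k' - k)`. -/
def CondCovDecay (P : Measure Ω) (C u θ : ℝ) (ξK : ℝ → ℕ → Ω → ℝ)
    (F : ℕ → Filtration ℕ mΩ) (G : ℕ → ℝ → ℕ → ℕ → Set Ω) (b : ℝ → ℕ → ℝ) : Prop :=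
  ∀ K : ℝ, 1 ≤ K → ∀ n l k k' : ℕ, k ≤ k' → l + k' < n →
    ∀ᵐ ω ∂P, ω ∈ G n K l k →
      |(P[centered P (ξK K (l + k)) * centered P (ξK K (l + k')) | F n l]) ω - b K (k' - k)| ≤
        C * ((l : ℝ) + 1) ^ u * K ^ u * Real.exp (u * ((k' : ℝ) - k)) * θ ^ k

/-- `ρ` is a (measurable, nonnegative) density of `Q` with respect to `P`. -/
def HasDensity (Q P : Measure Ω) (ρ : Ω → ℝ) : Prop :=
  Measurable ρ ∧ (∀ ω, 0 ≤ ρ ω) ∧ Q = P.withDensity (fun ω => ENNReal.ofReal (ρ ω))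

/-- (D1): polynomial bound on the densities. -/
def DensityBound (P : Measure Ω) (C u : ℝ) (ρ : ℕ → Ω → ℝ) : Prop :=
  ∀ n : ℕ, 1 ≤ n → ∀ᵐ ω ∂P, ρ n ω ≤ C * (n : ℝ) ^ u

/-- (D2): approximation of the densities by `F n k`-measurable functions, `k < n`. -/
def DensityApprox (P : Measure Ω) (C u θ : ℝ) (F : ℕ → Filtration ℕ mΩ)
    (ρ : ℕ → Ω → ℝ) : Prop :=
  ∀ n k : ℕ, k < n → ∃ r : Ω → ℝ, Measurable[F n k] r ∧
    P.real {ω | θ ^ k ≤ |ρ n ω - r ω|} ≤ C * (n : ℝ) ^ u * θ ^ k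

/-- The truncation level `K_n = n^((1+ε)/s)`. -/
noncomputable def level (s ε : ℝ) (n : ℕ) : ℝ := (n : ℝ) ^ ((1 + ε) / s)

/-- (D3): `L¹` truncation estimate with respect to the measures `Pn n`. -/
def DensityTruncation (Pn : ℕ → Measure Ω) (C s ε : ℝ) (ξ : ℕ → Ω → ℝ)
    (ξK : ℝ → ℕ → Ω → ℝ) : Prop :=
  ∀ n : ℕ, 1 ≤ n → ∀ l : ℕ, (n : ℝ) ^ ε ≤ l → l ≤ n →
    ∫ ω, |ξ l ω - ξK (level s ε n) l ω| ∂(Pn n) ≤ C * (level s ε n) ^ (1 - s)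

end WeakDepCLT

/-! ### Integrated form of the mixing hypotheses -/

namespace WeakDepCLT

variable {Ω : Type*} {mΩ : MeasurableSpace Ω}

/-! Everything rests on a one-step recurrence for f(l) = E[ρ cos(τ S_l + φ)], where S_l sums the
centred variables truncated at K = n^α over N ≤ i < l, with N = ⌈n^ε⌉ and τ = t/(σ√n). The phase φ
is free, so cosines replace complex exponentials: a shift by π/2 produces the derivative term, and
the phases 0 and -π/2 recover the characteristic function at the end.

Cut off a window of w terms before time l, and let a be the argument of the cosine before that
window, V the window sum and x = X_l. To second order (`abs_cos_increment_le`) the increment is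
cos(a + π/2) τx - τ² cos(a)(Vx + x²/2). The coefficients depend only on the past before the window,
so the mixing hypotheses apply across a gap: the linear term has negligible mean, and the quadratic
one averages to β E[ρ cos a], with β = b_{K,0}/2 + ∑_{1≤j≤2g} b_{K,j}. Small lags use the covariance
hypothesis; large lags use the decay of means, since X_{l-j} is then almost measurable well before
time l (`abs_integral_mul_window_sub_le`). The cubic remainder is of order |τ|³ K w², because one
factor is bounded in supremum norm and the other two in L² under the density
(`integral_density_remainder_le`). Thus f(l+1) = (1 - τ²β) f(l) + error
(`abs_cosExpectation_succ_sub_le`). With g of size n^κ, κ small, the n errors sum to o(1), and since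
β → σ²/2 the power (1 - τ²β)^(n-L) tends to exp(-t²/2) (`Mixing.tendsto_cosExpectation`).

The numbers b_{K,j} are limits of truncated covariances, so (H1) makes them Cauchy in K at rate
K^(-(s-2)/2), uniformly in j (`Truncation.abs_integral_mul_sub_le`). They also decay exponentially
in j, at a polynomial cost in K (`exists_abs_covLimit_le`). Taking K exponential in j combines the
two into summability of the limits (`exists_covLimit`). Nonnegativity of the variance comes from
second moments of sums (`Mixing.covSum_nonneg`) and a Cesàro argument.

Finally the truncation is removed in L¹ (`tendsto_integral_cos_of_density`), which gives (b); (a) is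
the density 1 together with the negligibility of the first n^ε terms
(`tendsto_integral_cos_of_density_one`). -/

lemma integrable_of_abs_le {P : Measure Ω} [IsFiniteMeasure P] {f : Ω → ℝ} {B : ℝ}
    (hf : AEStronglyMeasurable f P) (hB : ∀ᵐ ω ∂P, |f ω| ≤ B) : Integrable f P :=
  Integrable.of_bound hf B (by simpa [Real.norm_eq_abs] using hB)

/-- The device that eliminates exceptional events: a crude bound off `S` is paid for by the small
probability of the complement. -/
lemma integral_abs_le_of_le_on {P : Measure Ω} [IsProbabilityMeasure P] {Z : Ω → ℝ} {D ε : ℝ}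
    {S : Set Ω} (hS : MeasurableSet S) (hε : 0 ≤ ε)
    (hD : ∀ᵐ ω ∂P, |Z ω| ≤ D) (hZS : ∀ᵐ ω ∂P, ω ∈ S → |Z ω| ≤ ε) :
    ∫ ω, |Z ω| ∂P ≤ ε + D * P.real Sᶜ := by
  have hi : Integrable (fun ω => ε + Sᶜ.indicator (fun _ => D) ω) P :=
    (integrable_const ε).add ((integrable_const D).indicator hS.compl)
  calc ∫ ω, |Z ω| ∂P ≤ ∫ ω, (ε + Sᶜ.indicator (fun _ => D) ω) ∂P := by
        refine integral_mono_of_nonneg (Eventually.of_forall fun ω => abs_nonneg _) hi ?_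
        filter_upwards [hD, hZS] with ω h1 h2
        by_cases h : ω ∈ S
        · simpa [h] using h2 h
        · simpa [h] using h1.trans (by linarith)
    _ = ε + D * P.real Sᶜ := by
        rw [integral_add (integrable_const ε) ((integrable_const D).indicator hS.compl),
          integral_indicator hS.compl]
        simp [mul_comm]

lemma abs_integral_mul_le_mul {P : Measure Ω} {f g : Ω → ℝ} {B : ℝ}
    (hf : ∀ᵐ ω ∂P, |f ω| ≤ B) (hg : Integrable g P) :
    |∫ ω, f ω * g ω ∂P| ≤ B * ∫ ω, |g ω| ∂P := by
  calc |∫ ω, f ω * g ω ∂P| ≤ ∫ ω, |f ω * g ω| ∂P := abs_integral_le_integral_abs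
    _ ≤ ∫ ω, B * |g ω| ∂P := by
        refine integral_mono_of_nonneg (Eventually.of_forall fun ω => abs_nonneg _)
          (hg.abs.const_mul B) ?_
        filter_upwards [hf] with ω h
        rw [abs_mul]
        exact mul_le_mul_of_nonneg_right h (abs_nonneg _)
    _ = B * ∫ ω, |g ω| ∂P := integral_const_mul _ _

/-- An `m`-measurable bounded factor can be pulled out of the conditional expectation, so a
conditional estimate becomes one against every bounded test variable of the past. -/
lemma abs_integral_mul_le_condExp {P : Measure Ω} [IsProbabilityMeasure P]
    {m : MeasurableSpace Ω} (hm : m ≤ mΩ) {T Y : Ω → ℝ} {B : ℝ} (hT : Measurable[m] T)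
    (hB : ∀ᵐ ω ∂P, |T ω| ≤ B) (hY : Integrable Y P) :
    |∫ ω, T ω * Y ω ∂P| ≤ B * ∫ ω, |(P[Y | m]) ω| ∂P := by
  have h1 : P[T * Y | m] =ᵐ[P] T * P[Y | m] :=
    condExp_stronglyMeasurable_mul_of_bound hm hT.stronglyMeasurable hY B
      (by simpa [Real.norm_eq_abs] using hB)
  have h2 : ∫ ω, T ω * Y ω ∂P = ∫ ω, T ω * (P[Y | m]) ω ∂P := by
    have h3 := integral_congr_ae h1
    rw [integral_condExp hm] at h3
    exact h3
  rw [h2]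
  exact abs_integral_mul_le_mul hB integrable_condExp

/-- The mixing hypotheses in integrated form, for bounded centred variables `X K l`. -/
structure Mixing (P : Measure Ω) (A v θ : ℝ) (X : ℝ → ℕ → Ω → ℝ)
    (F : ℕ → Filtration ℕ mΩ) (b : ℝ → ℕ → ℝ) : Prop where
  measurable : ∀ K : ℝ, 1 ≤ K → ∀ l, Measurable (X K l)
  bounded : ∀ K : ℝ, 1 ≤ K → ∀ l, ∀ᵐ ω ∂P, |X K l ω| ≤ 2 * K
  bounded_limit : ∀ K : ℝ, 1 ≤ K → ∀ j, |b K j| ≤ 4 * K ^ 2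
  approx : ∀ K : ℝ, 1 ≤ K → ∀ n l k : ℕ, l + k < n →
    ∃ η : Ω → ℝ, Measurable[F n (l + k)] η ∧ (∀ᵐ ω ∂P, |η ω| ≤ 2 * K) ∧
      ∫ ω, |X K l ω - η ω| ∂P ≤ A * (K * n) ^ v * θ ^ k
  mean : ∀ K : ℝ, 1 ≤ K → ∀ n l k : ℕ, l + k < n → ∀ (T : Ω → ℝ) (B : ℝ), 0 ≤ B →
    Measurable[F n l] T → (∀ᵐ ω ∂P, |T ω| ≤ B) →
    |∫ ω, T ω * X K (l + k) ω ∂P| ≤ B * (A * (K * n) ^ v * θ ^ k)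
  cov : ∀ K : ℝ, 1 ≤ K → ∀ n l k k' : ℕ, k ≤ k' → l + k' < n → ∀ (T : Ω → ℝ) (B : ℝ), 0 ≤ B →
    Measurable[F n l] T → (∀ᵐ ω ∂P, |T ω| ≤ B) →
    |∫ ω, T ω * (X K (l + k) ω * X K (l + k') ω - b K (k' - k)) ∂P| ≤
      B * (A * (K * n) ^ v * Real.exp (v * ((k' : ℝ) - k)) * θ ^ k)

lemma abs_mul_le_four_sq {K x y : ℝ} (hx : |x| ≤ 2 * K) (hy : |y| ≤ 2 * K) :
    |x * y| ≤ 4 * K ^ 2 := by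
  rw [abs_mul]
  calc |x| * |y| ≤ (2 * K) * (2 * K) :=
        mul_le_mul hx hy (abs_nonneg _) ((abs_nonneg _).trans hx)
    _ = 4 * K ^ 2 := by ring

lemma measurable_centered {P : Measure Ω} {Y : Ω → ℝ} (hY : Measurable Y) : Measurable (centered P Y) :=
  hY.sub_const _

section PowerBounds

variable {K N : ℝ}

lemma rpow_mul_rpow_le (hK : 1 ≤ K) (hN : 1 ≤ N) {a c d : ℝ} (ha : a ≤ d) (hc : c ≤ d) :
    K ^ a * N ^ c ≤ (K * N) ^ d := by
  rw [Real.mul_rpow (by linarith) (by linarith)]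
  exact mul_le_mul (Real.rpow_le_rpow_of_exponent_le hK ha)
    (Real.rpow_le_rpow_of_exponent_le hN hc) (by positivity) (by positivity)

end PowerBounds

section OfHypotheses

variable {P : Measure Ω} [IsProbabilityMeasure P] {C u θ s : ℝ}
  {ξ : ℕ → Ω → ℝ} {ξK : ℝ → ℕ → Ω → ℝ} {F : ℕ → Filtration ℕ mΩ}
  {G : ℕ → ℝ → ℕ → ℕ → Set Ω} {b : ℝ → ℕ → ℝ}

lemma abs_centered_le {Y : Ω → ℝ} {K : ℝ} (hY : ∀ᵐ ω ∂P, |Y ω| ≤ K) :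
    ∀ᵐ ω ∂P, |centered P Y ω| ≤ 2 * K := by
  have h : |∫ ω, Y ω ∂P| ≤ K := by
    have := norm_integral_le_of_norm_le_const (μ := P) (f := Y) (C := K)
      (by simpa [Real.norm_eq_abs] using hY)
    simpa using this
  filter_upwards [hY] with ω hω
  exact (abs_sub _ _).trans (by linarith)

/-- Conditional covariances of variables bounded by 2K are at most 4K², and they approach `b K j` on
good events as the gap k grows. The hypothesis is used at l = 0 with horizon n = k + j + 1. -/
lemma abs_covLimit_le (hθ0 : 0 < θ) (hθ1 : θ < 1)
    (H1 : Truncation P C s ξ ξK) (hG : GoodEvents P C θ G)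
    (H4 : CondCovDecay P C u θ ξK F G b) {K : ℝ} (hK : 1 ≤ K) (j : ℕ) :
    |b K j| ≤ 4 * K ^ 2 := by
  have hlim : Tendsto (fun k : ℕ => 4 * K ^ 2 + C * (((0 : ℕ) : ℝ) + 1) ^ u * K ^ u *
      Real.exp (u * j) * θ ^ k) atTop (𝓝 (4 * K ^ 2)) := by
    have := (tendsto_pow_atTop_nhds_zero_of_lt_one hθ0.le hθ1).const_mul
      (C * (((0 : ℕ) : ℝ) + 1) ^ u * K ^ u * Real.exp (u * j))
    simpa using this.const_add (4 * K ^ 2)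
  have hsmall : ∀ᶠ k : ℕ in atTop, C * θ ^ k < 1 := by
    have := (tendsto_pow_atTop_nhds_zero_of_lt_one hθ0.le hθ1).const_mul C
    rw [mul_zero] at this
    exact this.eventually (gt_mem_nhds one_pos)
  refine ge_of_tendsto hlim ?_
  filter_upwards [hsmall] with k hk
  have hn : 0 + (k + j) < k + j + 1 := by omega
  obtain ⟨hGm, hGp⟩ := hG K hK (k + j + 1) 0 k (by omega)
  -- This is where Cθ^k < 1 enters: a null good event would have a complement of probability 1.
  have hpos : P (G (k + j + 1) K 0 k) ≠ 0 := by
    intro h0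
    have h1 := prob_compl_eq_one_sub (μ := P) hGm
    rw [h0, tsub_zero] at h1
    rw [Measure.real, h1] at hGp
    simp at hGp
    linarith
  have h4 := H4 K hK (k + j + 1) 0 k (k + j) (by omega) hn
  have hb : ∀ᵐ ω ∂P, |(P[centered P (ξK K (0 + k)) * centered P (ξK K (0 + (k + j))) |
      F (k + j + 1) 0]) ω| ≤ 4 * K ^ 2 := by
    refine ae_bdd_abs_condExp_of_ae_bdd_abs ?_
    filter_upwards [abs_centered_le (H1.bounded K hK (0 + k)),
      abs_centered_le (H1.bounded K hK (0 + (k + j)))] with ω h1 h2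
    exact abs_mul_le_four_sq h1 h2
  have hex : ∃ ω, ω ∈ G (k + j + 1) K 0 k ∧
      |(P[centered P (ξK K (0 + k)) * centered P (ξK K (0 + (k + j))) |
        F (k + j + 1) 0]) ω| ≤ 4 * K ^ 2 ∧
      |(P[centered P (ξK K (0 + k)) * centered P (ξK K (0 + (k + j))) |
        F (k + j + 1) 0]) ω - b K (k + j - k)| ≤ C * (((0 : ℕ) : ℝ) + 1) ^ u * K ^ u *
          Real.exp (u * (((k + j : ℕ) : ℝ) - k)) * θ ^ k := by
    -- Since `b K j` is deterministic, a single sample point satisfying both bounds is enough.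
    have := (frequently_ae_mem_iff.2 hpos).and_eventually (hb.and h4)
    obtain ⟨ω, h1, h2, h3⟩ := this.exists
    exact ⟨ω, h1, h2, h3 h1⟩
  obtain ⟨ω, _, h2, h3⟩ := hex
  have e1 : ((k + j : ℕ) : ℝ) - k = j := by push_cast; ring
  rw [e1, Nat.add_sub_cancel_left] at h3
  have := abs_le.1 h2
  have := abs_le.1 h3
  exact abs_le.2 ⟨by linarith, by linarith⟩

/-- Off the good events the integrands are O(K) or O(K²) and the probability is at most Cθ^k, so
integration removes the events. The inequality l + 1 ≤ n trades growth in l for growth in n, and the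
exponent u + 2 absorbs the extra factors K and K². The constant 9C is C from (H4) plus 8C from the
crude bound 8K² on the bad event; the 1 covers the term θ^k in `approx`. -/
theorem mixing_of_hypotheses (hC : 0 < C) (hu : 0 < u) (hθ0 : 0 < θ) (hθ1 : θ < 1)
    (H1 : Truncation P C s ξ ξK) (H2 : AdaptedApprox P C u θ ξK F) (hG : GoodEvents P C θ G)
    (H3 : CondMeanDecay P C u θ ξK F G) (H4 : CondCovDecay P C u θ ξK F G b) :
    Mixing P (1 + 9 * C) (u + 2) θ (fun K l => centered P (ξK K l)) F b where
  measurable K hK l := measurable_centered (H1.measurable K hK l)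
  bounded K hK l := abs_centered_le (H1.bounded K hK l)
  bounded_limit K hK j := abs_covLimit_le hθ0 hθ1 H1 hG H4 hK j
  approx K hK n l k hlk := by
    obtain ⟨η, hη, hηb, hηi, hηp⟩ := H2 K hK n l k hlk
    have hη' : Measurable η := hη.mono ((F n).le _) le_rfl
    have hθk : 0 ≤ θ ^ k := by positivity
    have hn : (l : ℝ) + 1 ≤ n := by exact_mod_cast (by omega : l + 1 ≤ n)
    have hn1 : (1 : ℝ) ≤ n := by linarith [Nat.cast_nonneg (α := ℝ) l]
    refine ⟨centered P η, hη.sub_const _, abs_centered_le hηb, ?_⟩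
    -- Equality of the two means makes centring harmless: the same constant is subtracted from both.
    have e : ∀ ω, centered P (ξK K l) ω - centered P η ω = ξK K l ω - η ω := fun ω => by
      simp only [centered, hηi]; ring
    simp_rw [e]
    have hS : MeasurableSet {ω | |ξK K l ω - η ω| < θ ^ k} :=
      measurableSet_lt ((H1.measurable K hK l).sub hη').abs measurable_const
    have key := integral_abs_le_of_le_on (P := P) (Z := fun ω => ξK K l ω - η ω)
      (D := 2 * K) hS hθk (by
        filter_upwards [H1.bounded K hK l, hηb] with ω h1 h2
        exact (abs_sub _ _).trans (by linarith)) (Eventually.of_forall fun ω h => le_of_lt h)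
    have hc : {ω | |ξK K l ω - η ω| < θ ^ k}ᶜ = {ω | θ ^ k ≤ |ξK K l ω - η ω|} := by
      ext ω; simp
    rw [hc] at key
    have h1 : (1 : ℝ) ≤ (K * n) ^ (u + 2) :=
      Real.one_le_rpow (by nlinarith) (by linarith)
    have h2 : K * (K ^ u * ((l : ℝ) + 1) ^ u) ≤ (K * n) ^ (u + 2) := by
      calc K * (K ^ u * ((l : ℝ) + 1) ^ u) ≤ K * (K ^ u * (n : ℝ) ^ u) := by gcongr
        _ = K ^ (u + 1) * (n : ℝ) ^ u := by
          rw [Real.rpow_add (by linarith), Real.rpow_one]; ring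
        _ ≤ _ := rpow_mul_rpow_le hK hn1 (by linarith) (by linarith)
    calc _ ≤ θ ^ k + 2 * K * (C * K ^ u * ((l : ℝ) + 1) ^ u * θ ^ k) := key.trans (by gcongr)
      _ = (1 + 2 * C * (K * (K ^ u * ((l : ℝ) + 1) ^ u))) * θ ^ k := by ring
      _ ≤ ((K * n) ^ (u + 2) + 2 * C * (K * n) ^ (u + 2)) * θ ^ k := by gcongr
      _ ≤ (1 + 9 * C) * (K * n) ^ (u + 2) * θ ^ k := by
        gcongr
        nlinarith
  mean K hK n l k hlk T B hB hT hTB := by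
    have hX := measurable_centered (P := P) (H1.measurable K hK (l + k))
    have hXb := abs_centered_le (H1.bounded K hK (l + k))
    obtain ⟨hGm, hGp⟩ := hG K hK n l k hlk
    have hθk : 0 ≤ θ ^ k := by positivity
    have hn : (l : ℝ) + 1 ≤ n := by exact_mod_cast (by omega : l + 1 ≤ n)
    have hn1 : (1 : ℝ) ≤ n := by linarith [Nat.cast_nonneg (α := ℝ) l]
    refine (abs_integral_mul_le_condExp ((F n).le l) hT hTB
      (integrable_of_abs_le hX.aestronglyMeasurable hXb)).trans ?_
    refine mul_le_mul_of_nonneg_left ?_ hB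
    have key := integral_abs_le_of_le_on hGm (by positivity)
      (ae_bdd_abs_condExp_of_ae_bdd_abs (m := F n l) hXb) (H3 K hK n l k hlk)
    have h2 : ((l : ℝ) + 1) ^ u * K ^ u ≤ (K * n) ^ (u + 2) := by
      calc ((l : ℝ) + 1) ^ u * K ^ u ≤ (n : ℝ) ^ u * K ^ u := by gcongr
        _ = K ^ u * (n : ℝ) ^ u := by ring
        _ ≤ _ := rpow_mul_rpow_le hK hn1 (by linarith) (by linarith)
    have h3 : K ≤ (K * n) ^ (u + 2) := by
      simpa using rpow_mul_rpow_le hK hn1 (a := 1) (c := 0) (d := u + 2) (by linarith) (by linarith)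
    have h1 : (0 : ℝ) ≤ (K * n) ^ (u + 2) := by positivity
    calc _ ≤ C * ((l : ℝ) + 1) ^ u * K ^ u * θ ^ k + 2 * K * (C * θ ^ k) := key.trans (by gcongr)
      _ = (C * (((l : ℝ) + 1) ^ u * K ^ u) + 2 * C * K) * θ ^ k := by ring
      _ ≤ (C * (K * n) ^ (u + 2) + 2 * C * (K * n) ^ (u + 2)) * θ ^ k := by gcongr
      _ ≤ (1 + 9 * C) * (K * n) ^ (u + 2) * θ ^ k := by
        gcongr
        nlinarith
  cov K hK n l k k' hkk hlk T B hB hT hTB := by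
    have hX := measurable_centered (P := P) (H1.measurable K hK (l + k))
    have hXb := abs_centered_le (H1.bounded K hK (l + k))
    have hX' := measurable_centered (P := P) (H1.measurable K hK (l + k'))
    have hXb' := abs_centered_le (H1.bounded K hK (l + k'))
    obtain ⟨hGm, hGp⟩ := hG K hK n l k (by omega)
    have hθk : 0 ≤ θ ^ k := by positivity
    have hn : (l : ℝ) + 1 ≤ n := by exact_mod_cast (by omega : l + 1 ≤ n)
    have hn1 : (1 : ℝ) ≤ n := by linarith [Nat.cast_nonneg (α := ℝ) l]
    have hkk' : (k : ℝ) ≤ k' := by exact_mod_cast hkk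
    have hXX : ∀ᵐ ω ∂P, |(centered P (ξK K (l + k)) * centered P (ξK K (l + k'))) ω| ≤
        4 * K ^ 2 := by
      filter_upwards [hXb, hXb'] with ω h1 h2
      exact abs_mul_le_four_sq h1 h2
    have hXXi : Integrable (centered P (ξK K (l + k)) * centered P (ξK K (l + k'))) P :=
      integrable_of_abs_le (hX.mul hX').aestronglyMeasurable hXX
    have hYi := hXXi.sub (integrable_const (b K (k' - k)))
    refine (abs_integral_mul_le_condExp ((F n).le l) hT hTB hYi).trans ?_
    refine mul_le_mul_of_nonneg_left ?_ hB
    have hce : P[(centered P (ξK K (l + k)) * centered P (ξK K (l + k'))) -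
        (fun _ => b K (k' - k)) | F n l] =ᵐ[P]
        fun ω => (P[centered P (ξK K (l + k)) * centered P (ξK K (l + k')) | F n l]) ω -
          b K (k' - k) := by
      refine (condExp_sub hXXi (integrable_const _) (F n l)).trans ?_
      rw [condExp_const ((F n).le l)]
      rfl
    have hbb := abs_covLimit_le hθ0 hθ1 H1 hG H4 hK (k' - k)
    have key := integral_abs_le_of_le_on (P := P) (Z := fun ω =>
        (P[centered P (ξK K (l + k)) * centered P (ξK K (l + k')) | F n l]) ω - b K (k' - k))
      (D := 8 * K ^ 2) hGm (by positivity) (by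
        filter_upwards [ae_bdd_abs_condExp_of_ae_bdd_abs (m := F n l) hXX] with ω h
        exact (abs_sub _ _).trans (by linarith)) (H4 K hK n l k k' hkk hlk)
    have h2 : ((l : ℝ) + 1) ^ u * K ^ u ≤ (K * n) ^ (u + 2) := by
      calc ((l : ℝ) + 1) ^ u * K ^ u ≤ (n : ℝ) ^ u * K ^ u := by gcongr
        _ = K ^ u * (n : ℝ) ^ u := by ring
        _ ≤ _ := rpow_mul_rpow_le hK hn1 (by linarith) (by linarith)
    have h3 : K ^ 2 ≤ (K * n) ^ (u + 2) := by
      have := rpow_mul_rpow_le hK hn1 (a := 2) (c := 0) (d := u + 2) (by linarith) (by linarith)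
      simpa using this
    have h1 : (0 : ℝ) ≤ (K * n) ^ (u + 2) := by positivity
    have h4 : Real.exp (u * ((k' : ℝ) - k)) ≤ Real.exp ((u + 2) * ((k' : ℝ) - k)) :=
      Real.exp_le_exp.2 (by nlinarith)
    have h5 : (1 : ℝ) ≤ Real.exp ((u + 2) * ((k' : ℝ) - k)) :=
      Real.one_le_exp (by nlinarith)
    have e : ∫ ω, |(P[(centered P (ξK K (l + k)) * centered P (ξK K (l + k'))) -
        (fun _ => b K (k' - k)) | F n l]) ω| ∂P = ∫ ω, |(P[centered P (ξK K (l + k)) *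
          centered P (ξK K (l + k')) | F n l]) ω - b K (k' - k)| ∂P := by
      refine integral_congr_ae ?_
      filter_upwards [hce] with ω h
      rw [h]
    refine e.le.trans ?_
    calc _ ≤ C * ((l : ℝ) + 1) ^ u * K ^ u * Real.exp (u * ((k' : ℝ) - k)) * θ ^ k
          + 8 * K ^ 2 * (C * θ ^ k) := key.trans (by gcongr)
      _ = (C * (((l : ℝ) + 1) ^ u * K ^ u) * Real.exp (u * ((k' : ℝ) - k)) + 8 * C * K ^ 2 * 1)
          * θ ^ k := by ring
      _ ≤ (C * (K * n) ^ (u + 2) * Real.exp ((u + 2) * ((k' : ℝ) - k)) +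
          8 * C * (K * n) ^ (u + 2) * Real.exp ((u + 2) * ((k' : ℝ) - k))) * θ ^ k := by gcongr
      _ = (9 * C) * (K * n) ^ (u + 2) * Real.exp ((u + 2) * ((k' : ℝ) - k)) * θ ^ k := by ring
      _ ≤ (1 + 9 * C) * (K * n) ^ (u + 2) * Real.exp ((u + 2) * ((k' : ℝ) - k)) * θ ^ k := by
        gcongr
        linarith

end OfHypotheses

end WeakDepCLT

/-! ### Test variables that are only approximately measurable with respect to the past -/

namespace WeakDepCLT

variable {Ω : Type*} {mΩ : MeasurableSpace Ω}

/-- `T` is bounded by `B` and within `δ` in `L¹` of an `m`-measurable variable bounded by `B`. -/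
structure Approximable (P : Measure Ω) (m : MeasurableSpace Ω) (T : Ω → ℝ) (B δ : ℝ) : Prop where
  measurable : Measurable[mΩ] T
  bounded : ∀ᵐ ω ∂P, |T ω| ≤ B
  exists_approx : ∃ T' : Ω → ℝ, Measurable[m] T' ∧ (∀ᵐ ω ∂P, |T' ω| ≤ B) ∧
    ∫ ω, |T ω - T' ω| ∂P ≤ δ

namespace Approximable

variable {P : Measure Ω} [IsProbabilityMeasure P] {m m' : MeasurableSpace Ω} {T T₁ T₂ : Ω → ℝ}
  {B B₁ B₂ δ δ' δ₁ δ₂ : ℝ}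

omit [IsProbabilityMeasure P] in
lemma mono (h : Approximable P m T B δ) (hm : m ≤ m') (hδ : δ ≤ δ') :
    Approximable P m' T B δ' := by
  obtain ⟨T', h1, h2, h3⟩ := h.exists_approx
  exact ⟨h.measurable, h.bounded, T', h1.mono hm le_rfl, h2, h3.trans hδ⟩

lemma integrable (h : Approximable P m T B δ) : Integrable T P :=
  integrable_of_abs_le h.measurable.aestronglyMeasurable h.bounded

lemma bound_nonneg (h : Approximable P m T B δ) : 0 ≤ B := by
  obtain ⟨ω, hω⟩ := h.bounded.exists
  exact (abs_nonneg _).trans hω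

/-- The product rule T₁T₂ - S₁S₂ = T₂(T₁ - S₁) + S₁(T₂ - S₂); requiring the approximants to obey the
same bounds as the originals is what makes it close up. -/
lemma mul (hm : m ≤ mΩ) (h₁ : Approximable P m T₁ B₁ δ₁) (h₂ : Approximable P m T₂ B₂ δ₂) :
    Approximable P m (fun ω => T₁ ω * T₂ ω) (B₁ * B₂) (B₂ * δ₁ + B₁ * δ₂) := by
  have hB₁ := h₁.bound_nonneg
  have hB₂ := h₂.bound_nonneg
  have i₁ := h₁.integrable
  have i₂ := h₂.integrable
  have hb := h₁.bounded
  have hb₂ := h₂.bounded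
  obtain ⟨S₁, a₁, b₁, c₁⟩ := h₁.exists_approx
  obtain ⟨S₂, a₂, b₂, c₂⟩ := h₂.exists_approx
  have j₁ := integrable_of_abs_le (a₁.mono hm le_rfl).aestronglyMeasurable b₁
  have j₂ := integrable_of_abs_le (a₂.mono hm le_rfl).aestronglyMeasurable b₂
  have k₁ : Integrable (fun ω => |T₁ ω - S₁ ω|) P := (i₁.sub j₁).abs
  have k₂ : Integrable (fun ω => |T₂ ω - S₂ ω|) P := (i₂.sub j₂).abs
  refine ⟨h₁.measurable.mul h₂.measurable, ?_, fun ω => S₁ ω * S₂ ω, a₁.mul a₂, ?_, ?_⟩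
  · filter_upwards [hb, hb₂] with ω h h'
    rw [abs_mul]
    exact mul_le_mul h h' (abs_nonneg _) hB₁
  · filter_upwards [b₁, b₂] with ω h h'
    rw [abs_mul]
    exact mul_le_mul h h' (abs_nonneg _) hB₁
  · calc ∫ ω, |T₁ ω * T₂ ω - S₁ ω * S₂ ω| ∂P
        ≤ ∫ ω, (B₂ * |T₁ ω - S₁ ω| + B₁ * |T₂ ω - S₂ ω|) ∂P := by
          refine integral_mono_of_nonneg (Eventually.of_forall fun ω => abs_nonneg _)
            ((k₁.const_mul _).add (k₂.const_mul _)) ?_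
          filter_upwards [hb₂, b₁] with ω h h'
          have e : T₁ ω * T₂ ω - S₁ ω * S₂ ω =
            T₂ ω * (T₁ ω - S₁ ω) + S₁ ω * (T₂ ω - S₂ ω) := by ring
          rw [e]
          refine (abs_add_le _ _).trans ?_
          rw [abs_mul, abs_mul]
          gcongr
      _ = B₂ * ∫ ω, |T₁ ω - S₁ ω| ∂P + B₁ * ∫ ω, |T₂ ω - S₂ ω| ∂P := by
          rw [integral_add (k₁.const_mul _) (k₂.const_mul _),
            integral_const_mul, integral_const_mul]
      _ ≤ _ := by gcongr

/-- The cosine is 1-Lipschitz, so the errors add; its bound 1 does not see the size of the sum. -/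
lemma cos_sum (hm : m ≤ mΩ) {ι : Type*} {s : Finset ι} {Y : ι → Ω → ℝ} {B δ : ι → ℝ}
    (h : ∀ i ∈ s, Approximable P m (Y i) (B i) (δ i)) (τ φ : ℝ) :
    Approximable P m (fun ω => Real.cos (τ * ∑ i ∈ s, Y i ω + φ)) 1 (|τ| * ∑ i ∈ s, δ i) := by
  classical
  have hex : ∀ i, ∃ S : Ω → ℝ, i ∈ s → Measurable[m] S ∧ (∀ᵐ ω ∂P, |S ω| ≤ B i) ∧
      ∫ ω, |Y i ω - S ω| ∂P ≤ δ i := fun i => by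
    by_cases hi : i ∈ s
    · obtain ⟨S, hS⟩ := (h i hi).exists_approx
      exact ⟨S, fun _ => hS⟩
    · exact ⟨0, fun h => absurd h hi⟩
  choose S hS using hex
  have hint : ∀ i ∈ s, Integrable (fun ω => |Y i ω - S i ω|) P := fun i hi =>
    ((h i hi).integrable.sub (integrable_of_abs_le
      ((hS i hi).1.mono hm le_rfl).aestronglyMeasurable (hS i hi).2.1)).abs
  refine ⟨?_, Eventually.of_forall fun ω => Real.abs_cos_le_one _,
    fun ω => Real.cos (τ * ∑ i ∈ s, S i ω + φ), ?_,
    Eventually.of_forall fun ω => Real.abs_cos_le_one _, ?_⟩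
  · exact Real.measurable_cos.comp (((Finset.measurable_fun_sum s
      fun i hi => (h i hi).measurable).const_mul τ).add_const φ)
  · exact Real.measurable_cos.comp (((Finset.measurable_fun_sum s
      fun i hi => (hS i hi).1).const_mul τ).add_const φ)
  · calc ∫ ω, |Real.cos (τ * ∑ i ∈ s, Y i ω + φ) - Real.cos (τ * ∑ i ∈ s, S i ω + φ)| ∂P
        ≤ ∫ ω, |τ| * ∑ i ∈ s, |Y i ω - S i ω| ∂P := by
          refine integral_mono_of_nonneg (Eventually.of_forall fun ω => abs_nonneg _)
            ((integrable_finsetSum s hint).const_mul _) (Eventually.of_forall fun ω => ?_)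
          refine (Real.abs_cos_sub_cos_le _ _).trans ?_
          have e : τ * ∑ i ∈ s, Y i ω + φ - (τ * ∑ i ∈ s, S i ω + φ) =
              τ * ∑ i ∈ s, (Y i ω - S i ω) := by
            rw [Finset.sum_sub_distrib]; ring
          rw [e, abs_mul]
          exact mul_le_mul_of_nonneg_left (Finset.abs_sum_le_sum_abs _ _) (abs_nonneg _)
      _ = |τ| * ∑ i ∈ s, ∫ ω, |Y i ω - S i ω| ∂P := by
          rw [integral_const_mul, integral_finsetSum s hint]
      _ ≤ _ := by
          gcongr with i hi
          exact (hS i hi).2.2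

end Approximable

namespace Mixing

variable {P : Measure Ω} [IsProbabilityMeasure P] {A v θ : ℝ} {X : ℝ → ℕ → Ω → ℝ}
  {F : ℕ → Filtration ℕ mΩ} {b : ℝ → ℕ → ℝ} {K : ℝ} {n l k k' : ℕ} {T : Ω → ℝ} {B δ : ℝ}

omit [IsProbabilityMeasure P] in
lemma approximable (hX : Mixing P A v θ X F b) (hK : 1 ≤ K) (hlk : l + k < n) :
    Approximable P (F n (l + k)) (X K l) (2 * K) (A * (K * n) ^ v * θ ^ k) :=
  ⟨hX.measurable K hK l, hX.bounded K hK l, hX.approx K hK n l k hlk⟩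

lemma integrable (hX : Mixing P A v θ X F b) (hK : 1 ≤ K) (l : ℕ) : Integrable (X K l) P :=
  integrable_of_abs_le (hX.measurable K hK l).aestronglyMeasurable (hX.bounded K hK l)

lemma integrable_mul (hX : Mixing P A v θ X F b) (hK : 1 ≤ K) (i j : ℕ) :
    Integrable (fun ω => X K i ω * X K j ω) P := by
  refine integrable_of_abs_le (B := 4 * K ^ 2)
    ((hX.measurable K hK i).mul (hX.measurable K hK j)).aestronglyMeasurable ?_
  filter_upwards [hX.bounded K hK i, hX.bounded K hK j] with ω h h'
  exact abs_mul_le_four_sq h h'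

/-- Replacing a test variable by its approximant costs the supremum of the other factor times the L¹
error. This extends the mean and covariance estimates of `Mixing` to approximable tests. -/
lemma abs_integral_mul_le_of_approximable {Y T' : Ω → ℝ} {D E : ℝ} (hY : Integrable Y P)
    (hYD : ∀ᵐ ω ∂P, |Y ω| ≤ D) (hT : Integrable T P) (hT' : Integrable T' P)
    (hδ : ∫ ω, |T ω - T' ω| ∂P ≤ δ) (hE : |∫ ω, T' ω * Y ω ∂P| ≤ E) :
    |∫ ω, T ω * Y ω ∂P| ≤ E + D * δ := by
  have hD : 0 ≤ D := by
    obtain ⟨ω, hω⟩ := hYD.exists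
    exact (abs_nonneg _).trans hω
  have i1 : Integrable (fun ω => T' ω * Y ω) P := hT'.mul_bdd hY.aestronglyMeasurable
    (by simpa [Real.norm_eq_abs] using hYD)
  have i2 : Integrable (fun ω => Y ω * (T ω - T' ω)) P :=
    (hT.sub hT').bdd_mul hY.aestronglyMeasurable (by simpa [Real.norm_eq_abs] using hYD)
  have e : ∫ ω, T ω * Y ω ∂P = ∫ ω, T' ω * Y ω ∂P + ∫ ω, Y ω * (T ω - T' ω) ∂P := by
    rw [← integral_add i1 i2]
    exact integral_congr_ae (Eventually.of_forall fun ω => by simp only; ring)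
  rw [e]
  refine (abs_add_le _ _).trans (add_le_add hE ?_)
  exact (abs_integral_mul_le_mul hYD (hT.sub hT')).trans (by
    simp only [Pi.sub_apply]; gcongr)

lemma abs_integral_mul_le (hX : Mixing P A v θ X F b) (hK : 1 ≤ K) (hlk : l + k < n)
    (hT : Approximable P (F n l) T B δ) :
    |∫ ω, T ω * X K (l + k) ω ∂P| ≤ B * (A * (K * n) ^ v * θ ^ k) + 2 * K * δ := by
  obtain ⟨T', h1, h2, h3⟩ := hT.exists_approx
  exact abs_integral_mul_le_of_approximable (hX.integrable hK _) (hX.bounded K hK _) hT.integrable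
    (integrable_of_abs_le (h1.mono ((F n).le l) le_rfl).aestronglyMeasurable h2) h3
    (hX.mean K hK n l k hlk T' B hT.bound_nonneg h1 h2)

lemma abs_integral_mul_mul_sub_le (hX : Mixing P A v θ X F b) (hK : 1 ≤ K) (hkk : k ≤ k')
    (hlk : l + k' < n) (hT : Approximable P (F n l) T B δ) :
    |∫ ω, T ω * (X K (l + k) ω * X K (l + k') ω) ∂P - b K (k' - k) * ∫ ω, T ω ∂P| ≤
      B * (A * (K * n) ^ v * Real.exp (v * ((k' : ℝ) - k)) * θ ^ k) + 8 * K ^ 2 * δ := by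
  obtain ⟨T', h1, h2, h3⟩ := hT.exists_approx
  have hXX := hX.integrable_mul hK (l + k) (l + k')
  have i1 : Integrable (fun ω => T ω * (X K (l + k) ω * X K (l + k') ω)) P :=
    hXX.bdd_mul hT.measurable.aestronglyMeasurable
      (by simpa [Real.norm_eq_abs] using hT.bounded)
  have e : ∫ ω, T ω * (X K (l + k) ω * X K (l + k') ω) ∂P - b K (k' - k) * ∫ ω, T ω ∂P =
      ∫ ω, T ω * (X K (l + k) ω * X K (l + k') ω - b K (k' - k)) ∂P := by
    rw [← integral_const_mul, ← integral_sub i1 (hT.integrable.const_mul _)]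
    exact integral_congr_ae (Eventually.of_forall fun ω => by simp only; ring)
  rw [e]
  refine abs_integral_mul_le_of_approximable (hXX.sub (integrable_const _)) ?_ hT.integrable
    (integrable_of_abs_le (h1.mono ((F n).le l) le_rfl).aestronglyMeasurable h2) h3
    (hX.cov K hK n l k k' hkk hlk T' B hT.bound_nonneg h1 h2)
  filter_upwards [hX.bounded K hK (l + k), hX.bounded K hK (l + k')] with ω h h'
  exact (abs_sub _ _).trans (by
    linarith [abs_mul_le_four_sq h h', hX.bounded_limit K hK (k' - k)])

end Mixing

end WeakDepCLT

/-! ### Second moments and limits of the covariance numbers -/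

namespace WeakDepCLT

variable {Ω : Type*} {mΩ : MeasurableSpace Ω}

section Moments

variable {P : Measure Ω} [IsProbabilityMeasure P]

lemma integral_sq_centered_le {Y : Ω → ℝ} (hY : MemLp Y 2 P) :
    ∫ ω, centered P Y ω ^ 2 ∂P ≤ ∫ ω, Y ω ^ 2 ∂P := by
  have h1 : Integrable Y P := hY.integrable one_le_two
  have h2 := hY.integrable_sq
  set c := ∫ ω, Y ω ∂P with hc
  have e : ∫ ω, centered P Y ω ^ 2 ∂P = ∫ ω, (Y ω ^ 2 - (2 * c * Y ω - c ^ 2)) ∂P := by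
    refine integral_congr_ae (Eventually.of_forall fun ω => ?_)
    simp only [centered, ← hc]; ring
  have h3 : Integrable (fun ω => 2 * c * Y ω) P := h1.const_mul _
  have h4 : Integrable (fun ω => 2 * c * Y ω - c ^ 2) P := h3.sub (integrable_const _)
  rw [e, integral_sub h2 h4, integral_sub h3 (integrable_const _), integral_const_mul, ← hc]
  simp only [integral_const, probReal_univ, smul_eq_mul, one_mul]
  nlinarith [sq_nonneg c]

omit [IsProbabilityMeasure P] in
lemma integral_sq_sub_le {f g h : Ω → ℝ} (hf : MemLp f 2 P) (hg : MemLp g 2 P)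
    (hh : MemLp h 2 P) :
    ∫ ω, (f ω - h ω) ^ 2 ∂P ≤
      2 * ∫ ω, (f ω - g ω) ^ 2 ∂P + 2 * ∫ ω, (h ω - g ω) ^ 2 ∂P := by
  have i1 : Integrable (fun ω => (f ω - g ω) ^ 2) P := (hf.sub hg).integrable_sq
  have i2 : Integrable (fun ω => (h ω - g ω) ^ 2) P := (hh.sub hg).integrable_sq
  rw [← integral_const_mul, ← integral_const_mul,
    ← integral_add (i1.const_mul 2) (i2.const_mul 2)]
  refine integral_mono_of_nonneg (Eventually.of_forall fun ω => sq_nonneg _)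
    ((i1.const_mul 2).add (i2.const_mul 2)) (Eventually.of_forall fun ω => ?_)
  simp only
  nlinarith [sq_nonneg (f ω - g ω + (h ω - g ω))]

variable {C s : ℝ} {ξ : ℕ → Ω → ℝ} {ξK : ℝ → ℕ → Ω → ℝ}

lemma Truncation.memLp_trunc (H1 : Truncation P C s ξ ξK) {K : ℝ} (hK : 1 ≤ K) (l : ℕ) :
    MemLp (ξK K l) 2 P :=
  MemLp.of_bound (H1.measurable K hK l).aestronglyMeasurable K
    (by simpa [Real.norm_eq_abs] using H1.bounded K hK l)

lemma Truncation.integral_sq_sub_le (H1 : Truncation P C s ξ ξK) (hC : 0 < C) (hs : 2 < s)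
    {K K' : ℝ} (hK : 1 ≤ K) (hKK : K ≤ K') (l : ℕ) :
    ∫ ω, (ξK K l ω - ξK K' l ω) ^ 2 ∂P ≤ 4 * C * K ^ (2 - s) := by
  have h := WeakDepCLT.integral_sq_sub_le (H1.memLp_trunc hK l) (H1.memLp l)
    (H1.memLp_trunc (hK.trans hKK) l)
  have h1 := H1.l2_error K hK l
  have h2 := H1.l2_error K' (hK.trans hKK) l
  have h3 : K' ^ (2 - s) ≤ K ^ (2 - s) :=
    Real.rpow_le_rpow_of_nonpos (by linarith) hKK (by linarith)
  have := mul_le_mul_of_nonneg_left h3 hC.le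
  linarith

lemma Truncation.integral_sq_centered_sub_le (H1 : Truncation P C s ξ ξK) (hC : 0 < C)
    (hs : 2 < s) {K K' : ℝ} (hK : 1 ≤ K) (hKK : K ≤ K') (l : ℕ) :
    ∫ ω, (centered P (ξK K l) ω - centered P (ξK K' l) ω) ^ 2 ∂P ≤ 4 * C * K ^ (2 - s) := by
  have m1 := H1.memLp_trunc hK l
  have m2 := H1.memLp_trunc (hK.trans hKK) l
  refine le_trans (le_of_eq ?_) ((integral_sq_centered_le (m1.sub m2)).trans
    (H1.integral_sq_sub_le hC hs hK hKK l))
  refine integral_congr_ae (Eventually.of_forall fun ω => ?_)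
  simp only [centered, Pi.sub_apply,
    integral_sub (m1.integrable one_le_two) (m2.integrable one_le_two)]
  ring

/-- Comparison with the truncation at level 1, which is bounded by 1, gives a bound independent of
both K and l. -/
lemma Truncation.integral_sq_centered_le (H1 : Truncation P C s ξ ξK) (hC : 0 < C)
    (hs : 2 < s) {K : ℝ} (hK : 1 ≤ K) (l : ℕ) :
    ∫ ω, centered P (ξK K l) ω ^ 2 ∂P ≤ 8 * C + 2 := by
  refine (WeakDepCLT.integral_sq_centered_le (H1.memLp_trunc hK l)).trans ?_
  have m0 : MemLp (fun _ : Ω => (0 : ℝ)) 2 P := MemLp.zero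
  have h := WeakDepCLT.integral_sq_sub_le (H1.memLp_trunc hK l) (H1.memLp_trunc le_rfl l) m0
  have h1 := H1.integral_sq_sub_le hC hs le_rfl hK l
  have h2 : ∫ ω, (0 - ξK 1 l ω) ^ 2 ∂P ≤ 1 := by
    have : ∫ ω, (0 - ξK 1 l ω) ^ 2 ∂P ≤ ∫ _ : Ω, (1 : ℝ) ∂P := by
      refine integral_mono_of_nonneg (Eventually.of_forall fun ω => sq_nonneg _)
        (integrable_const _) ?_
      filter_upwards [H1.bounded 1 le_rfl l] with ω h
      simpa using h
    simpa using this
  have h3 : ∫ ω, (ξK K l ω - ξK 1 l ω) ^ 2 ∂P = ∫ ω, (ξK 1 l ω - ξK K l ω) ^ 2 ∂P :=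
    integral_congr_ae (Eventually.of_forall fun ω => by simp only; ring)
  simp only [sub_zero, Real.one_rpow] at h h1
  linarith

/-- Cauchy–Schwarz in substance: the factors are O(1) in L² and their changes between levels are
O(K^(-(s-2)/2)). Uniformity in i and j lets the bound pass to the limits `b K j`. -/
lemma Truncation.abs_integral_mul_sub_le (H1 : Truncation P C s ξ ξK) (hC : 0 < C)
    (hs : 2 < s) {K K' : ℝ} (hK : 1 ≤ K) (hKK : K ≤ K') (i j : ℕ) :
    |∫ ω, centered P (ξK K i) ω * centered P (ξK K j) ω ∂P -
      ∫ ω, centered P (ξK K' i) ω * centered P (ξK K' j) ω ∂P| ≤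
      (12 * C + 2) * K ^ (-((s - 2) / 2)) := by
  have hK0 : 0 < K := by linarith
  have m : ∀ {L : ℝ}, 1 ≤ L → ∀ l, MemLp (centered P (ξK L l)) 2 P := fun hL l =>
    (H1.memLp_trunc hL l).sub (memLp_const _)
  have hK' := hK.trans hKK
  set w := K ^ (-((s - 2) / 2)) with hw
  have hw0 : 0 < w := Real.rpow_pos_of_pos hK0 _
  have hww : K ^ (2 - s) = w * w := by
    rw [hw, ← Real.rpow_add hK0]; congr 1; ring
  have q1 := (m hK i).integrable_sq
  have q2 := (m hK' j).integrable_sq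
  have q3 : Integrable (fun ω => (centered P (ξK K i) ω - centered P (ξK K' i) ω) ^ 2) P :=
    ((m hK i).sub (m hK' i)).integrable_sq
  have q4 : Integrable (fun ω => (centered P (ξK K j) ω - centered P (ξK K' j) ω) ^ 2) P :=
    ((m hK j).sub (m hK' j)).integrable_sq
  have p1 : Integrable (fun ω => centered P (ξK K i) ω * centered P (ξK K j) ω) P :=
    (m hK i).integrable_mul (m hK j)
  have p2 : Integrable (fun ω => centered P (ξK K' i) ω * centered P (ξK K' j) ω) P :=
    (m hK' i).integrable_mul (m hK' j)
  rw [← integral_sub p1 p2]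
  refine abs_integral_le_integral_abs.trans ?_
  have i1 : Integrable (fun ω => w * centered P (ξK K i) ω ^ 2 +
      w⁻¹ * (centered P (ξK K j) ω - centered P (ξK K' j) ω) ^ 2) P :=
    (q1.const_mul w).add (q4.const_mul w⁻¹)
  have i2 : Integrable (fun ω => w * centered P (ξK K' j) ω ^ 2 +
      w⁻¹ * (centered P (ξK K i) ω - centered P (ξK K' i) ω) ^ 2) P :=
    (q2.const_mul w).add (q3.const_mul w⁻¹)
  have key : ∫ ω, |(centered P (ξK K i) ω * centered P (ξK K j) ω -
      centered P (ξK K' i) ω * centered P (ξK K' j) ω)| ∂P ≤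
      ∫ ω, 1 / 2 * ((w * centered P (ξK K i) ω ^ 2 +
          w⁻¹ * (centered P (ξK K j) ω - centered P (ξK K' j) ω) ^ 2) +
        (w * centered P (ξK K' j) ω ^ 2 +
          w⁻¹ * (centered P (ξK K i) ω - centered P (ξK K' i) ω) ^ 2)) ∂P := by
    refine integral_mono_of_nonneg (Eventually.of_forall fun ω => abs_nonneg _)
      ((i1.add i2).const_mul _) (Eventually.of_forall fun ω => ?_)
    simp only
    -- The weight w is the L² size of the truncation differences, so both terms are of order w after
    -- integration.
    have amgm : ∀ x y : ℝ, |x * y| ≤ 1 / 2 * (w * x ^ 2 + w⁻¹ * y ^ 2) := fun x y => by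
      have e1 : w * x ^ 2 + w⁻¹ * y ^ 2 - 2 * |x * y| = w⁻¹ * (w * |x| - |y|) ^ 2 := by
        rw [abs_mul, sub_sq, mul_pow, sq_abs, sq_abs]
        field_simp
        ring
      have e2 : 0 ≤ w⁻¹ * (w * |x| - |y|) ^ 2 := by positivity
      linarith
    have e : centered P (ξK K i) ω * centered P (ξK K j) ω -
        centered P (ξK K' i) ω * centered P (ξK K' j) ω =
        centered P (ξK K i) ω * (centered P (ξK K j) ω - centered P (ξK K' j) ω) +
        centered P (ξK K' j) ω * (centered P (ξK K i) ω - centered P (ξK K' i) ω) := by ring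
    rw [e, mul_add (1 / 2)]
    exact (abs_add_le _ _).trans (add_le_add (amgm _ _) (amgm _ _))
  have ei : ∫ ω, 1 / 2 * ((w * centered P (ξK K i) ω ^ 2 +
          w⁻¹ * (centered P (ξK K j) ω - centered P (ξK K' j) ω) ^ 2) +
        (w * centered P (ξK K' j) ω ^ 2 +
          w⁻¹ * (centered P (ξK K i) ω - centered P (ξK K' i) ω) ^ 2)) ∂P =
      1 / 2 * ((w * ∫ ω, centered P (ξK K i) ω ^ 2 ∂P +
          w⁻¹ * ∫ ω, (centered P (ξK K j) ω - centered P (ξK K' j) ω) ^ 2 ∂P) +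
        (w * ∫ ω, centered P (ξK K' j) ω ^ 2 ∂P +
          w⁻¹ * ∫ ω, (centered P (ξK K i) ω - centered P (ξK K' i) ω) ^ 2 ∂P)) := by
    rw [integral_const_mul, integral_add i1 i2, integral_add (q1.const_mul w) (q4.const_mul w⁻¹),
      integral_add (q2.const_mul w) (q3.const_mul w⁻¹)]
    simp only [integral_const_mul]
  refine key.trans (ei.le.trans ?_)
  have b1 := H1.integral_sq_centered_le hC hs hK i
  have b2 := H1.integral_sq_centered_le hC hs hK' j
  have b3 := H1.integral_sq_centered_sub_le hC hs hK hKK i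
  have b4 := H1.integral_sq_centered_sub_le hC hs hK hKK j
  rw [hww] at b3 b4
  have hinv : w⁻¹ * (4 * C * (w * w)) = 4 * C * w := by field_simp
  calc _ ≤ 1 / 2 * ((w * (8 * C + 2) + w⁻¹ * (4 * C * (w * w))) +
        (w * (8 * C + 2) + w⁻¹ * (4 * C * (w * w)))) := by gcongr
    _ = (12 * C + 2) * w := by rw [hinv]; ring

end Moments

lemma exists_rpow_le_exp {a μ : ℝ} (ha : 0 < a) (hμ : 0 < μ) :
    ∃ c : ℝ, 0 < c ∧ ∀ x : ℝ, 0 < x → x ^ a ≤ c * Real.exp (μ * x) := by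
  refine ⟨Real.exp (-(a * Real.log (μ / a))), Real.exp_pos _, fun x hx => ?_⟩
  have h1 : Real.log (μ / a * x) ≤ μ / a * x := by
    have := Real.log_le_sub_one_of_pos (x := μ / a * x) (by positivity)
    linarith
  rw [Real.log_mul (by positivity) hx.ne'] at h1
  rw [Real.rpow_def_of_pos hx, ← Real.exp_add, Real.exp_le_exp]
  have h2 := mul_le_mul_of_nonneg_left h1 ha.le
  have e : a * (μ / a * x) = μ * x := by field_simp
  rw [e] at h2
  linarith

namespace Mixing

variable {P : Measure Ω} [IsProbabilityMeasure P] {A v θ : ℝ} {X : ℝ → ℕ → Ω → ℝ}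
  {F : ℕ → Filtration ℕ mΩ} {b : ℝ → ℕ → ℝ} {K : ℝ}

lemma abs_integral_mul_sub_le (hX : Mixing P A v θ X F b) (hK : 1 ≤ K) (k j : ℕ) :
    |∫ ω, X K k ω * X K (k + j) ω ∂P - b K j| ≤
      A * (K * ((k + j + 1 : ℕ) : ℝ)) ^ v * Real.exp (v * j) * θ ^ k := by
  have hT : Approximable P (F (k + j + 1) 0) (fun _ => (1 : ℝ)) 1 0 :=
    ⟨measurable_const, by simp, fun _ => 1, measurable_const, by simp, by simp⟩
  have h := hX.abs_integral_mul_mul_sub_le hK (n := k + j + 1) (l := 0) (k := k) (k' := k + j)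
    (by omega) (by omega) hT
  have e : ((k + j : ℕ) : ℝ) - k = j := by push_cast; ring
  rw [e, Nat.add_sub_cancel_left] at h
  simpa using h

/-- The polynomial factor coming from the horizon k + j + 1 loses to θ^k. This identifies `b K j` as
an asymptotic lag-j covariance, the link between the given numbers and actual moments. -/
lemma tendsto_integral_mul (hX : Mixing P A v θ X F b) (hθ0 : 0 < θ) (hθ1 : θ < 1)
    (hK : 1 ≤ K) (j : ℕ) :
    Tendsto (fun k : ℕ => ∫ ω, X K k ω * X K (k + j) ω ∂P) atTop (𝓝 (b K j)) := by
  have hl : 0 < -Real.log θ := neg_pos.2 (Real.log_neg hθ0 hθ1)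
  have h0 : Tendsto (fun k : ℕ => ((k + j + 1 : ℕ) : ℝ) ^ v *
      Real.exp (-(-Real.log θ) * ((k + j + 1 : ℕ) : ℝ))) atTop (𝓝 0) :=
    (tendsto_rpow_mul_exp_neg_mul_atTop_nhds_zero v _ hl).comp
      (tendsto_natCast_atTop_atTop.comp (tendsto_add_atTop_nat (j + 1)))
  have h1 := h0.const_mul (A * K ^ v * Real.exp (v * j) * Real.exp (-Real.log θ * (j + 1)))
  rw [mul_zero] at h1
  rw [tendsto_iff_norm_sub_tendsto_zero]
  refine squeeze_zero (fun _ => norm_nonneg _) (fun k => ?_) h1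
  refine (hX.abs_integral_mul_sub_le hK k j).trans (le_of_eq ?_)
  have e : θ ^ k = Real.exp (-Real.log θ * (j + 1)) *
      Real.exp (-(-Real.log θ) * ((k + j + 1 : ℕ) : ℝ)) := by
    rw [← Real.exp_add, ← Real.rpow_natCast, Real.rpow_def_of_pos hθ0]
    congr 1; push_cast; ring
  rw [e, Real.mul_rpow (by linarith) (by positivity)]
  ring

/-- Compare `b K j` with E[X_k X_{k+j}] at a time k proportional to j. That covariance is small by
itself: X_k is nearly measurable at time k + j/2, and the mean of X_{k+j} decays over the remaining
half. Keeping k linear in j leaves only a polynomial loss. -/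
lemma exists_abs_covLimit_le (hX : Mixing P A v θ X F b) (hA : 0 < A) (hv : 0 < v) (hθ0 : 0 < θ)
    (hθ1 : θ < 1) :
    ∃ c μ : ℝ, 0 < c ∧ 0 < μ ∧ ∀ K : ℝ, 1 ≤ K → ∀ j : ℕ,
      |b K j| ≤ c * K ^ (v + 1) * Real.exp (-(μ * j)) := by
  set κ := -Real.log θ with hκ
  have hκ0 : 0 < κ := neg_pos.2 (Real.log_neg hθ0 hθ1)
  have hθk : ∀ k : ℕ, θ ^ k = Real.exp (-(κ * k)) := fun k => by
    rw [← Real.rpow_natCast, Real.rpow_def_of_pos hθ0, hκ]; congr 1; ring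
  obtain ⟨c, hc, hcx⟩ := exists_rpow_le_exp hv (by positivity : 0 < κ / 4)
  -- With k = Mj, the factor θ^k beats exp(vj) and still leaves exp(-κj).
  obtain ⟨M, hM⟩ := exists_nat_ge ((v + κ) / κ)
  rw [div_le_iff₀ hκ0] at hM
  refine ⟨5 * (A * (((M : ℝ) + 1) ^ v * (c * Real.exp (κ / 4)))) * Real.exp (κ / 2), κ / 4,
    by positivity, by positivity, fun K hK j => ?_⟩
  have hK0 : 0 < K := by linarith
  set k := M * j with hk
  set m := j / 2 with hm
  set Λ := A * (K * ((k + j + 1 : ℕ) : ℝ)) ^ v with hΛ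
  have hΛ0 : 0 ≤ Λ := by positivity
  have hmj : m + (j - m) = j := by omega
  have hmm : m ≤ j - m := by omega
  have h1 := hX.abs_integral_mul_sub_le hK k j
  have h2 := hX.abs_integral_mul_le hK (n := k + j + 1) (l := k + m) (k := j - m) (by omega)
    (hX.approximable hK (n := k + j + 1) (l := k) (k := m) (by omega))
  rw [add_assoc, hmj] at h2
  have h3 : θ ^ (j - m) ≤ θ ^ m := pow_le_pow_of_le_one hθ0.le hθ1.le hmm
  have h4 : Real.exp (v * j) * θ ^ k ≤ θ ^ m := by
    rw [hθk, hθk, ← Real.exp_add, Real.exp_le_exp, hk]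
    push_cast
    have h5 : (m : ℝ) ≤ j := by exact_mod_cast (by omega : m ≤ j)
    have hj : (0 : ℝ) ≤ j := Nat.cast_nonneg j
    nlinarith [mul_le_mul_of_nonneg_right hM hj]
  have h6 : |b K j| ≤ 5 * K * Λ * θ ^ m := by
    have a1 : Λ * (Real.exp (v * j) * θ ^ k) ≤ K * Λ * θ ^ m := by
      calc Λ * (Real.exp (v * j) * θ ^ k) ≤ Λ * θ ^ m := by gcongr
        _ ≤ K * (Λ * θ ^ m) := le_mul_of_one_le_left (by positivity) hK
        _ = _ := by ring
    have a2 : 2 * K * (Λ * θ ^ (j - m)) ≤ 2 * K * (Λ * θ ^ m) := by gcongr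
    have a3 := abs_sub_abs_le_abs_sub (b K j) (∫ ω, X K k ω * X K (k + j) ω ∂P)
    rw [abs_sub_comm] at a3
    linarith
  have h7 : ((k + j + 1 : ℕ) : ℝ) ^ v ≤
      ((M : ℝ) + 1) ^ v * (c * Real.exp (κ / 4) * Real.exp (κ / 4 * j)) := by
    have e1 : ((k + j + 1 : ℕ) : ℝ) ≤ ((M : ℝ) + 1) * ((j : ℝ) + 1) := by
      rw [hk]; push_cast
      nlinarith [Nat.cast_nonneg (α := ℝ) M]
    calc ((k + j + 1 : ℕ) : ℝ) ^ v ≤ (((M : ℝ) + 1) * ((j : ℝ) + 1)) ^ v := by gcongr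
      _ = ((M : ℝ) + 1) ^ v * ((j : ℝ) + 1) ^ v :=
        Real.mul_rpow (by positivity) (by positivity)
      _ ≤ ((M : ℝ) + 1) ^ v * (c * Real.exp (κ / 4 * (j + 1))) := by
        gcongr; exact hcx _ (by positivity)
      _ = _ := by rw [mul_assoc c, ← Real.exp_add]; congr 4; ring
  have h8 : θ ^ m ≤ Real.exp (κ / 2) * Real.exp (-(κ / 2 * j)) := by
    rw [hθk, ← Real.exp_add, Real.exp_le_exp]
    have : (j : ℝ) ≤ 2 * m + 1 := by exact_mod_cast (by omega : j ≤ 2 * m + 1)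
    nlinarith
  calc |b K j| ≤ 5 * K * Λ * θ ^ m := h6
    _ = 5 * K * (A * (K ^ v * ((k + j + 1 : ℕ) : ℝ) ^ v)) * θ ^ m := by
      rw [hΛ, Real.mul_rpow hK0.le (by positivity)]
    _ ≤ 5 * K * (A * (K ^ v * (((M : ℝ) + 1) ^ v * (c * Real.exp (κ / 4) *
        Real.exp (κ / 4 * j))))) * (Real.exp (κ / 2) * Real.exp (-(κ / 2 * j))) := by gcongr
    _ = 5 * (A * (((M : ℝ) + 1) ^ v * (c * Real.exp (κ / 4)))) * Real.exp (κ / 2) *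
        (K ^ v * K) * (Real.exp (κ / 4 * j) * Real.exp (-(κ / 2 * j))) := by ring
    _ = _ := by
      rw [Real.rpow_add hK0, Real.rpow_one, ← Real.exp_add]
      congr 2; ring

end Mixing

/-- The covariance numbers converge, at a polynomial rate in the truncation level, to a summable
sequence. -/
theorem exists_covLimit {b : ℝ → ℕ → ℝ} {D δ c μ v : ℝ} (hδ : 0 < δ) (hμ : 0 < μ) (hv : 0 < v)
    (hD : ∀ K K' : ℝ, 1 ≤ K → K ≤ K' → ∀ j, |b K j - b K' j| ≤ D * K ^ (-δ))
    (hb : ∀ K : ℝ, 1 ≤ K → ∀ j : ℕ, |b K j| ≤ c * K ^ (v + 1) * Real.exp (-(μ * j))) :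
    ∃ σ : ℕ → ℝ, (∀ j, Tendsto (fun K => b K j) atTop (𝓝 (σ j))) ∧
      (∀ K : ℝ, 1 ≤ K → ∀ j, |b K j - σ j| ≤ D * K ^ (-δ)) ∧ Summable σ := by
  have hlim : Tendsto (fun K : ℝ => D * K ^ (-δ)) atTop (𝓝 0) := by
    simpa using (tendsto_rpow_neg_atTop hδ).const_mul D
  have hex : ∀ j, ∃ x, Tendsto (fun K => b K j) atTop (𝓝 x) := fun j => by
    refine cauchySeq_tendsto_of_complete (Metric.cauchySeq_iff'.2 fun ε hε => ?_)
    obtain ⟨N, hN1, hN2⟩ := ((hlim.eventually (gt_mem_nhds hε)).and (eventually_ge_atTop 1)).exists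
    refine ⟨N, fun K hK => ?_⟩
    rw [dist_comm, Real.dist_eq]
    exact (hD N K hN2 hK j).trans_lt hN1
  choose σ hσ using hex
  have hbσ : ∀ K : ℝ, 1 ≤ K → ∀ j, |b K j - σ j| ≤ D * K ^ (-δ) := fun K hK j => by
    refine le_of_tendsto ((tendsto_const_nhds.sub (hσ j)).abs) ?_
    filter_upwards [eventually_ge_atTop K] with K' hK'
    exact hD K K' hK hK' j
  refine ⟨σ, hσ, hbσ, ?_⟩
  -- At K = exp(aj) the factor K^(v+1) equals exp(μj/2), half of the exponential decay, while the
  -- truncation error K^(-δ) is itself exponentially small in j.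
  set a := μ / (2 * (v + 1)) with ha
  have ha0 : 0 < a := by positivity
  have s1 : Summable fun j : ℕ => c * Real.exp (j * -(μ / 2)) :=
    (Real.summable_exp_nat_mul_iff.2 (by linarith)).mul_left c
  have s2 : Summable fun j : ℕ => D * Real.exp (j * -(a * δ)) :=
    (Real.summable_exp_nat_mul_iff.2 (by nlinarith)).mul_left D
  refine Summable.of_norm_bounded (s1.add s2) fun j => ?_
  have hK : 1 ≤ Real.exp (a * j) := Real.one_le_exp (by positivity)
  have h1 := hb _ hK j
  have h2 := hbσ _ hK j
  rw [← Real.exp_mul] at h1 h2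
  have e1 : c * Real.exp (a * j * (v + 1)) * Real.exp (-(μ * j)) =
      c * Real.exp (j * -(μ / 2)) := by
    rw [mul_assoc, ← Real.exp_add]
    congr 2
    rw [ha]; field_simp; ring
  have e2 : a * j * -δ = j * -(a * δ) := by ring
  rw [e1] at h1
  rw [e2] at h2
  have := abs_sub_abs_le_abs_sub (σ j) (b (Real.exp (a * j)) j)
  rw [abs_sub_comm] at this
  rw [Real.norm_eq_abs]
  linarith

/-- In truncated subtraction (i - j) + (j - i) is |i - j|; enlarging the square adds the corner and
two equal borders. -/
lemma covSum_succ (σ : ℕ → ℝ) (m : ℕ) :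
    ∑ i ∈ Finset.range (m + 1), ∑ j ∈ Finset.range (m + 1), σ ((i - j) + (j - i)) =
      ∑ i ∈ Finset.range m, ∑ j ∈ Finset.range m, σ ((i - j) + (j - i)) +
        (σ 0 + 2 * ∑ j ∈ Finset.range m, σ (j + 1)) := by
  have h : ∑ i ∈ Finset.range m, σ (m - i) = ∑ j ∈ Finset.range m, σ (j + 1) := by
    rw [← Finset.sum_range_reflect (fun j => σ (j + 1))]
    refine Finset.sum_congr rfl fun i hi => ?_
    have := Finset.mem_range.1 hi
    congr 1; omega
  have h1 : ∑ i ∈ Finset.range m, σ ((i - m) + (m - i)) = ∑ j ∈ Finset.range m, σ (j + 1) := by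
    rw [← h]
    refine Finset.sum_congr rfl fun i hi => ?_
    have := Finset.mem_range.1 hi
    congr 1; omega
  have h2 : ∑ i ∈ Finset.range m, σ ((m - i) + (i - m)) = ∑ j ∈ Finset.range m, σ (j + 1) := by
    rw [← h]
    refine Finset.sum_congr rfl fun i hi => ?_
    have := Finset.mem_range.1 hi
    congr 1; omega
  simp only [Finset.sum_range_succ, Finset.sum_add_distrib, h1, h2, Nat.sub_self, Nat.add_zero]
  ring

/-- The quadratic form divided by n is the Cesàro mean of the partial sums of σ 0 + 2∑σ (j+1), so it
has the same limit as they have. -/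
lemma nonneg_of_covSum_nonneg {σ : ℕ → ℝ} (hσ : Summable σ)
    (h : ∀ m, 0 ≤ ∑ i ∈ Finset.range m, ∑ j ∈ Finset.range m, σ ((i - j) + (j - i))) :
    0 ≤ σ 0 + 2 * ∑' j : ℕ, σ (j + 1) := by
  have h1 : Tendsto (fun m => σ 0 + 2 * ∑ j ∈ Finset.range m, σ (j + 1)) atTop
      (𝓝 (σ 0 + 2 * ∑' j : ℕ, σ (j + 1))) :=
    (((summable_nat_add_iff 1).2 hσ).hasSum.tendsto_sum_nat.const_mul 2).const_add (σ 0)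
  refine ge_of_tendsto' h1.cesaro fun n => ?_
  have e : ∑ m ∈ Finset.range n, (σ 0 + 2 * ∑ j ∈ Finset.range m, σ (j + 1)) =
      ∑ i ∈ Finset.range n, ∑ j ∈ Finset.range n, σ ((i - j) + (j - i)) := by
    induction n with
    | zero => simp
    | succ n ih => rw [Finset.sum_range_succ, ih, covSum_succ]
  rw [e]
  exact mul_nonneg (by positivity) (h n)

/-- The form is the limit, as k → ∞, of the second moment of X_k + ⋯ + X_{k+m-1}. -/
lemma Mixing.covSum_nonneg {P : Measure Ω} [IsProbabilityMeasure P] {A v θ : ℝ}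
    {X : ℝ → ℕ → Ω → ℝ} {F : ℕ → Filtration ℕ mΩ} {b : ℝ → ℕ → ℝ} {K : ℝ}
    (hX : Mixing P A v θ X F b) (hθ0 : 0 < θ) (hθ1 : θ < 1) (hK : 1 ≤ K) (m : ℕ) :
    0 ≤ ∑ i ∈ Finset.range m, ∑ j ∈ Finset.range m, b K ((i - j) + (j - i)) := by
  have hlim : ∀ i j : ℕ, Tendsto (fun k : ℕ => ∫ ω, X K (k + i) ω * X K (k + j) ω ∂P) atTop
      (𝓝 (b K ((i - j) + (j - i)))) := by
    have aux : ∀ i d : ℕ, Tendsto (fun k : ℕ => ∫ ω, X K (k + i) ω * X K (k + (i + d)) ω ∂P)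
        atTop (𝓝 (b K d)) := fun i d => by
      have := (hX.tendsto_integral_mul hθ0 hθ1 hK d).comp (tendsto_add_atTop_nat i)
      refine this.congr fun k => ?_
      simp only [Function.comp, add_assoc]
    intro i j
    rcases le_total i j with hij | hij
    · obtain ⟨d, rfl⟩ := Nat.exists_eq_add_of_le hij
      have e : i - (i + d) + (i + d - i) = d := by omega
      rw [e]
      exact aux i d
    · obtain ⟨d, rfl⟩ := Nat.exists_eq_add_of_le hij
      have e : j + d - j + (j - (j + d)) = d := by omega
      rw [e]
      refine (aux j d).congr fun k => ?_
      simp only [mul_comm]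
  refine ge_of_tendsto' (tendsto_finsetSum _ fun i _ => tendsto_finsetSum _ fun j _ => hlim i j)
    fun k => ?_
  have e : ∑ i ∈ Finset.range m, ∑ j ∈ Finset.range m, ∫ ω, X K (k + i) ω * X K (k + j) ω ∂P =
      ∫ ω, (∑ i ∈ Finset.range m, X K (k + i) ω) ^ 2 ∂P := by
    have hi : ∀ i j, Integrable (fun ω => X K (k + i) ω * X K (k + j) ω) P :=
      fun i j => hX.integrable_mul hK _ _
    simp_rw [sq, Finset.sum_mul_sum]
    rw [integral_finsetSum _ fun i _ => integrable_finsetSum _ fun j _ => hi i j]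
    exact Finset.sum_congr rfl fun i _ => (integral_finsetSum _ fun j _ => hi i j).symm
  rw [e]
  exact integral_nonneg fun ω => sq_nonneg _

end WeakDepCLT

/-! ### Cosine increments and mixing estimates across a gap -/

namespace WeakDepCLT

lemma abs_sin_sub_self_le {x : ℝ} (hx : |x| ≤ 1) : |Real.sin x - x| ≤ |x| ^ 3 * (1 / 4) := by
  have h := Real.sin_bound hx
  have h4 : |x| ^ 5 ≤ |x| ^ 3 := pow_le_pow_of_le_one (abs_nonneg x) hx (by norm_num)
  have e : Real.sin x - x = (Real.sin x - (x - x ^ 3 / 6)) + -(x ^ 3 / 6) := by ring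
  rw [e]
  refine (abs_add_le _ _).trans ?_
  rw [abs_neg, abs_div, abs_pow, abs_of_pos (by norm_num : (0 : ℝ) < 6)]
  have := pow_nonneg (abs_nonneg x) 3
  linarith

lemma abs_cos_sub_le {x : ℝ} (hx : |x| ≤ 1) :
    |Real.cos x - (1 - x ^ 2 / 2)| ≤ |x| ^ 3 * (1 / 4) := by
  have h := Real.cos_bound hx
  have h4 : |x| ^ 4 ≤ |x| ^ 3 := pow_le_pow_of_le_one (abs_nonneg x) hx (by norm_num)
  have := pow_nonneg (abs_nonneg x) 3
  linarith

/-- Second order expansion of an increment of the cosine, about a point preceding the increment. -/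
lemma abs_cos_increment_le (a : ℝ) {v x : ℝ} (hv : |v| ≤ 1) (hx : |x| ≤ 1) :
    |Real.cos (a + v + x) - Real.cos (a + v) -
      (Real.cos (a + Real.pi / 2) * x - Real.cos a * (v * x + x ^ 2 / 2))| ≤
      |x| * v ^ 2 + x ^ 2 * |v| + |x| ^ 3 := by
  rw [Real.cos_add_pi_div_two]
  set c := Real.cos (a + v) with hc
  set d := Real.sin (a + v) with hd
  -- Four cubic errors: the Taylor remainders of cos x and sin x, the replacement of cos(a + v) by
  -- cos a in the x² term, and the linearization in v of sin(a + v) in the linear term.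
  have e : Real.cos (a + v + x) - c - (-Real.sin a * x - Real.cos a * (v * x + x ^ 2 / 2)) =
      c * (Real.cos x - (1 - x ^ 2 / 2)) + -d * (Real.sin x - x) +
      (Real.cos a - c) * (x ^ 2 / 2) +
      -x * (Real.sin a * (Real.cos v - 1) + Real.cos a * (Real.sin v - v)) := by
    have h1 : d = Real.sin a * Real.cos v + Real.cos a * Real.sin v := Real.sin_add a v
    rw [Real.cos_add (a + v) x, ← hc, ← hd]
    linear_combination (-x) * h1
  have b1 : |c * (Real.cos x - (1 - x ^ 2 / 2))| ≤ |x| ^ 3 * (1 / 4) := by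
    rw [abs_mul]
    exact (mul_le_of_le_one_left (abs_nonneg _) (Real.abs_cos_le_one _)).trans (abs_cos_sub_le hx)
  have b2 : |-d * (Real.sin x - x)| ≤ |x| ^ 3 * (1 / 4) := by
    rw [abs_mul, abs_neg]
    exact (mul_le_of_le_one_left (abs_nonneg _) (Real.abs_sin_le_one _)).trans
      (abs_sin_sub_self_le hx)
  have b3 : |(Real.cos a - c) * (x ^ 2 / 2)| ≤ |v| * (x ^ 2 / 2) := by
    rw [abs_mul, abs_of_nonneg (by positivity : 0 ≤ x ^ 2 / 2)]
    refine mul_le_mul_of_nonneg_right ?_ (by positivity)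
    refine (Real.abs_cos_sub_cos_le _ _).trans (le_of_eq ?_)
    rw [← abs_neg]; congr 1; ring
  have b4 : |Real.sin a * (Real.cos v - 1) + Real.cos a * (Real.sin v - v)| ≤ v ^ 2 := by
    have h1 : |Real.cos v - 1| ≤ v ^ 2 / 2 := by
      rw [abs_le]
      constructor
      · linarith [Real.one_sub_sq_div_two_le_cos (x := v)]
      · linarith [Real.cos_le_one v, sq_nonneg v]
    have h2 : |Real.sin v - v| ≤ v ^ 2 / 2 := by
      refine (abs_sin_sub_self_le hv).trans ?_
      have : |v| ^ 3 ≤ v ^ 2 := by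
        rw [← sq_abs v]
        exact pow_le_pow_of_le_one (abs_nonneg v) hv (by norm_num)
      nlinarith [sq_nonneg v]
    refine (abs_add_le _ _).trans ?_
    rw [abs_mul, abs_mul]
    have h3 := mul_le_of_le_one_left (abs_nonneg (Real.cos v - 1)) (Real.abs_sin_le_one a)
    have h4 := mul_le_of_le_one_left (abs_nonneg (Real.sin v - v)) (Real.abs_cos_le_one a)
    linarith
  have b5 : |-x * (Real.sin a * (Real.cos v - 1) + Real.cos a * (Real.sin v - v))| ≤
      |x| * v ^ 2 := by
    rw [abs_mul, abs_neg]
    gcongr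
  rw [e]
  refine (abs_add_le _ _).trans ?_
  have c1 := abs_add_le (c * (Real.cos x - (1 - x ^ 2 / 2)) + -d * (Real.sin x - x))
    ((Real.cos a - c) * (x ^ 2 / 2))
  have c2 := abs_add_le (c * (Real.cos x - (1 - x ^ 2 / 2))) (-d * (Real.sin x - x))
  have p1 : 0 ≤ |x| ^ 3 := by positivity
  have p2 : 0 ≤ x ^ 2 * |v| := by positivity
  linarith

lemma sum_Ico_eq_add_sum_window (f : ℕ → ℝ) {N l : ℕ} (w : ℕ) (h : N + w ≤ l) :
    ∑ i ∈ Finset.Ico N l, f i =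
      ∑ i ∈ Finset.Ico N (l - w), f i + ∑ j ∈ Finset.range w, f (l - (j + 1)) := by
  induction w with
  | zero => simp
  | succ w ih =>
    rw [ih (by omega), Finset.sum_range_succ]
    have e : l - w = l - (w + 1) + 1 := by omega
    rw [e, Finset.sum_Ico_succ_top (by omega)]
    ring

variable {Ω : Type*} {mΩ : MeasurableSpace Ω}

/-- The common bound for all mixing errors across a gap of length `g`. -/
noncomputable def gapError (A v θ K R : ℝ) (n g : ℕ) : ℝ :=
  17 * K ^ 2 * R * n * (A * (K * n) ^ v) * θ ^ g

namespace Mixing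

variable {P : Measure Ω} [IsProbabilityMeasure P] {A v θ : ℝ} {X : ℝ → ℕ → Ω → ℝ}
  {F : ℕ → Filtration ℕ mΩ} {b : ℝ → ℕ → ℝ} {K R τ φ : ℝ} {n N g h l : ℕ} {T ρ : Ω → ℝ}

omit [IsProbabilityMeasure P] in
lemma integrable_mul_left (hX : Mixing P A v θ X F b) (hK : 1 ≤ K) (hT : Integrable T P) (i : ℕ) :
    Integrable (fun ω => T ω * X K i ω) P :=
  hT.mul_bdd (hX.measurable K hK i).aestronglyMeasurable
    (by simpa [Real.norm_eq_abs] using hX.bounded K hK i)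

omit [IsProbabilityMeasure P] in
lemma integrable_mul_left₂ (hX : Mixing P A v θ X F b) (hK : 1 ≤ K) (hT : Integrable T P)
    (i j : ℕ) : Integrable (fun ω => T ω * (X K i ω * X K j ω)) P := by
  refine (hX.integrable_mul_left hK (hX.integrable_mul_left hK hT i) j).congr
    (Eventually.of_forall fun ω => ?_)
  simp only; ring

lemma one_le_rate (hA : 1 ≤ A) (hv : 0 < v) (hK : 1 ≤ K) (hn : 1 ≤ n) :
    1 ≤ A * (K * n) ^ v := by
  have hn' : (1 : ℝ) ≤ n := by exact_mod_cast hn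
  have := Real.one_le_rpow (x := K * n) (z := v) (by nlinarith) hv.le
  nlinarith

lemma mul_le_gapError {c : ℝ} (hc : c ≤ 17)
    (h : 0 ≤ K ^ 2 * R * n * (A * (K * n) ^ v) * θ ^ g) :
    c * (K ^ 2 * R * n * (A * (K * n) ^ v) * θ ^ g) ≤ gapError A v θ K R n g := by
  have e : gapError A v θ K R n g = 17 * (K ^ 2 * R * n * (A * (K * n) ^ v) * θ ^ g) := by
    rw [gapError]; ring
  rw [e]
  exact mul_le_mul_of_nonneg_right hc h

/-- The density itself serves as the test variable at time i - g ≥ g, where it is known up to Rθ^g.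
The second moment under ρ is thus controlled by `b K 0`, not by the supremum bound 4K². -/
lemma integral_density_mul_sq_le (hX : Mixing P A v θ X F b) (hA : 1 ≤ A) (hv : 0 < v)
    (hθ0 : 0 < θ) (hθ1 : θ < 1) (hK : 1 ≤ K) (hR : 1 ≤ R)
    (hρ : ∀ k < n, Approximable P (F n k) ρ R (R * θ ^ k)) (hρ1 : ∫ ω, ρ ω ∂P = 1)
    {i : ℕ} (hi : 2 * g ≤ i) (hin : i < n) :
    ∫ ω, ρ ω * X K i ω ^ 2 ∂P ≤ |b K 0| + gapError A v θ K R n g := by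
  have hn : 1 ≤ n := by omega
  have hn' : (1 : ℝ) ≤ n := by exact_mod_cast hn
  have h1 := hX.abs_integral_mul_mul_sub_le hK (n := n) (l := i - g) (k := g) (k' := g) le_rfl
    (by omega) ((hρ (i - g) (by omega)).mono le_rfl
      (mul_le_mul_of_nonneg_left (pow_le_pow_of_le_one hθ0.le hθ1.le (by omega : g ≤ i - g))
        (by linarith)))
  have e : i - g + g = i := by omega
  rw [e, hρ1, sub_self, mul_zero, Real.exp_zero, Nat.sub_self] at h1
  have e2 : ∫ ω, ρ ω * X K i ω ^ 2 ∂P = ∫ ω, ρ ω * (X K i ω * X K i ω) ∂P := by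
    simp_rw [sq]
  rw [e2]
  have hΛ := one_le_rate hA hv hK hn
  have hK2 : 1 ≤ K ^ 2 := one_le_pow₀ hK
  set Λ := A * (K * n) ^ v with hΛd
  have h2 : R * (Λ * 1 * θ ^ g) + 8 * K ^ 2 * (R * θ ^ g) ≤ gapError A v θ K R n g := by
    have q1 : R * Λ ≤ K ^ 2 * R * n * Λ := by
      calc R * Λ = 1 * R * 1 * Λ := by ring
        _ ≤ _ := by gcongr
    have q2 : K ^ 2 * R ≤ K ^ 2 * R * n * Λ := by
      calc K ^ 2 * R = K ^ 2 * R * 1 * 1 := by ring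
        _ ≤ _ := by gcongr
    have q3 := mul_le_mul_of_nonneg_right q1 (pow_nonneg hθ0.le g)
    have q4 := mul_le_mul_of_nonneg_right q2 (pow_nonneg hθ0.le g)
    have q5 : 0 ≤ K ^ 2 * R * n * Λ * θ ^ g := by positivity
    have e3 : gapError A v θ K R n g = 17 * (K ^ 2 * R * n * Λ * θ ^ g) := by
      rw [gapError, ← hΛd]; ring
    rw [e3]
    linarith
  have h3 := (abs_sub_abs_le_abs_sub _ _).trans h1
  have h4 := le_abs_self (∫ ω, ρ ω * (X K i ω * X K i ω) ∂P)
  rw [mul_one] at h3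
  linarith

/-- A gap g after the last summand makes each of the at most n terms nearly measurable, and since m
≥ g the density is too. -/
lemma approximable_density_mul_cos (hX : Mixing P A v θ X F b) (hA : 1 ≤ A) (hv : 0 < v)
    (hθ0 : 0 < θ) (hθ1 : θ < 1) (hK : 1 ≤ K) (hR : 1 ≤ R) (hτ : |τ| ≤ 1)
    (hρ : ∀ k < n, Approximable P (F n k) ρ R (R * θ ^ k)) {a m : ℕ} (ham : a + g ≤ m)
    (hmn : m < n) (φ : ℝ) :
    Approximable P (F n m) (fun ω => ρ ω * Real.cos (τ * ∑ i ∈ Finset.Ico N a, X K i ω + φ)) R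
      (2 * R * n * (A * (K * n) ^ v) * θ ^ g) := by
  have hn : 1 ≤ n := by omega
  have hn' : (1 : ℝ) ≤ n := by exact_mod_cast hn
  have hΛ := one_le_rate hA hv hK hn
  set Λ := A * (K * n) ^ v with hΛd
  have hY : ∀ i ∈ Finset.Ico N a, Approximable P (F n m) (X K i) (2 * K) (Λ * θ ^ g) := by
    intro i hi
    have hi2 := (Finset.mem_Ico.1 hi).2
    have h := hX.approximable hK (n := n) (l := i) (k := m - i) (by omega)
    have e : i + (m - i) = m := by omega
    rw [e] at h
    exact h.mono le_rfl (mul_le_mul_of_nonneg_left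
      (pow_le_pow_of_le_one hθ0.le hθ1.le (by omega)) (by linarith))
  have h := (hρ m hmn).mul ((F n).le m) (Approximable.cos_sum ((F n).le m) hY τ φ)
  rw [mul_one] at h
  refine h.mono le_rfl ?_
  rw [Finset.sum_const, Nat.card_Ico, nsmul_eq_mul, one_mul]
  have h1 : ((a - N : ℕ) : ℝ) ≤ n := by exact_mod_cast (by omega : a - N ≤ n)
  have h2 : θ ^ m ≤ θ ^ g := pow_le_pow_of_le_one hθ0.le hθ1.le (by omega)
  calc R * θ ^ m + R * (|τ| * (((a - N : ℕ) : ℝ) * (Λ * θ ^ g)))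
      ≤ R * θ ^ g + R * (1 * (n * (Λ * θ ^ g))) := by gcongr
    _ ≤ R * (n * (Λ * θ ^ g)) + R * (1 * (n * (Λ * θ ^ g))) := by
        gcongr
        calc θ ^ g = 1 * (1 * θ ^ g) := by ring
          _ ≤ n * (Λ * θ ^ g) := by gcongr
    _ = _ := by ring

lemma abs_integral_mul_le_gapError (hX : Mixing P A v θ X F b) (hA : 1 ≤ A) (hv : 0 < v)
    (hθ0 : 0 < θ) (hθ1 : θ < 1) (hK : 1 ≤ K) (hR : 1 ≤ R) (hgh : g ≤ h) (hhl : h ≤ l) (hln : l < n)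
    (hT : Approximable P (F n (l - h)) T R (2 * R * n * (A * (K * n) ^ v) * θ ^ g)) :
    |∫ ω, T ω * X K l ω ∂P| ≤ gapError A v θ K R n g := by
  have hn : 1 ≤ n := by omega
  have hn' : (1 : ℝ) ≤ n := by exact_mod_cast hn
  have hΛ := one_le_rate hA hv hK hn
  have h1 := hX.abs_integral_mul_le hK (n := n) (l := l - h) (k := h) (by omega) hT
  have e : l - h + h = l := by omega
  rw [e] at h1
  set Λ := A * (K * n) ^ v with hΛd
  have hKK : K ≤ K ^ 2 := by nlinarith
  have h2 : θ ^ h ≤ θ ^ g := pow_le_pow_of_le_one hθ0.le hθ1.le hgh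
  refine h1.trans ?_
  calc R * (Λ * θ ^ h) + 2 * K * (2 * R * n * Λ * θ ^ g)
      ≤ R * (Λ * θ ^ g) + 2 * K ^ 2 * (2 * R * n * Λ * θ ^ g) := by gcongr
    _ = 1 * R * 1 * Λ * θ ^ g + 4 * (K ^ 2 * R * n * Λ * θ ^ g) := by ring
    _ ≤ K ^ 2 * R * n * Λ * θ ^ g + 4 * (K ^ 2 * R * n * Λ * θ ^ g) := by
        gcongr; nlinarith
    _ = 5 * (K ^ 2 * R * n * Λ * θ ^ g) := by ring
    _ ≤ _ := mul_le_gapError (by norm_num) (by positivity)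

/-- Small lags: the covariance estimate is applied across the gap h - j. The hypothesis `hj` says
that this gap compensates the factor exp(vj). -/
lemma abs_integral_mul_near_le (hX : Mixing P A v θ X F b) (hA : 1 ≤ A) (hv : 0 < v)
    (hθ0 : 0 < θ) (hK : 1 ≤ K) (hR : 1 ≤ R) (hhl : h ≤ l) (hln : l < n)
    (hT : Approximable P (F n (l - h)) T R (2 * R * n * (A * (K * n) ^ v) * θ ^ g))
    {j : ℕ} (hjh : j ≤ h) (hj : Real.exp (v * j) * θ ^ (h - j) ≤ θ ^ g) :
    |∫ ω, T ω * (X K (l - j) ω * X K l ω) ∂P - b K j * ∫ ω, T ω ∂P| ≤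
      gapError A v θ K R n g := by
  have hn : 1 ≤ n := by omega
  have hn' : (1 : ℝ) ≤ n := by exact_mod_cast hn
  have hΛ := one_le_rate hA hv hK hn
  have h1 := hX.abs_integral_mul_mul_sub_le hK (n := n) (l := l - h) (k := h - j) (k' := h)
    (by omega) (by omega) hT
  have e1 : l - h + (h - j) = l - j := by omega
  have e2 : l - h + h = l := by omega
  have e3 : h - (h - j) = j := by omega
  have e4 : (h : ℝ) - ((h - j : ℕ) : ℝ) = j := by
    rw [Nat.cast_sub hjh]; ring
  rw [e1, e2, e3, e4] at h1
  refine h1.trans ?_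
  set Λ := A * (K * n) ^ v with hΛd
  calc R * (Λ * Real.exp (v * j) * θ ^ (h - j)) + 8 * K ^ 2 * (2 * R * n * Λ * θ ^ g)
      = R * (Λ * (Real.exp (v * j) * θ ^ (h - j))) + 16 * (K ^ 2 * R * n * Λ * θ ^ g) := by ring
    _ ≤ R * (Λ * θ ^ g) + 16 * (K ^ 2 * R * n * Λ * θ ^ g) := by gcongr
    _ = 1 * R * 1 * Λ * θ ^ g + 16 * (K ^ 2 * R * n * Λ * θ ^ g) := by ring
    _ ≤ K ^ 2 * R * n * Λ * θ ^ g + 16 * (K ^ 2 * R * n * Λ * θ ^ g) := by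
        gcongr; nlinarith
    _ = 17 * (K ^ 2 * R * n * Λ * θ ^ g) := by ring
    _ ≤ _ := mul_le_gapError le_rfl (by positivity)

/-- Large lags: exp(vj) would be too costly, so X_{l-j} is absorbed into the test variable. A lag of
at least 2g leaves g steps to make it nearly measurable at time l - g and g more for the mean of X_l
to decay. -/
lemma abs_integral_mul_far_le (hX : Mixing P A v θ X F b) (hA : 1 ≤ A) (hv : 0 < v)
    (hθ0 : 0 < θ) (hθ1 : θ < 1) (hK : 1 ≤ K) (hR : 1 ≤ R) (hgh : g ≤ h) (hln : l < n)
    (hT : Approximable P (F n (l - h)) T R (2 * R * n * (A * (K * n) ^ v) * θ ^ g))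
    {j : ℕ} (hgj : 2 * g ≤ j) (hjl : j ≤ l) :
    |∫ ω, T ω * (X K (l - j) ω * X K l ω) ∂P| ≤ gapError A v θ K R n g := by
  have hn : 1 ≤ n := by omega
  have hn' : (1 : ℝ) ≤ n := by exact_mod_cast hn
  have hΛ := one_le_rate hA hv hK hn
  set Λ := A * (K * n) ^ v with hΛd
  have hY : Approximable P (F n (l - g)) (X K (l - j)) (2 * K) (Λ * θ ^ g) := by
    have h := hX.approximable hK (n := n) (l := l - j) (k := j - g) (by omega)
    have e : l - j + (j - g) = l - g := by omega
    rw [e] at h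
    exact h.mono le_rfl (mul_le_mul_of_nonneg_left
      (pow_le_pow_of_le_one hθ0.le hθ1.le (by omega)) (by linarith))
  have hT' := hT.mono ((F n).mono (by omega : l - h ≤ l - g)) le_rfl
  have h1 := hX.abs_integral_mul_le hK (n := n) (l := l - g) (k := g) (by omega)
    (hT'.mul ((F n).le _) hY)
  have e2 : l - g + g = l := by omega
  rw [e2] at h1
  simp_rw [mul_assoc (T _)] at h1
  refine h1.trans ?_
  have q1 : K * R * 1 * Λ * θ ^ g ≤ K ^ 2 * R * n * Λ * θ ^ g := by gcongr; nlinarith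
  calc R * (2 * K) * (Λ * θ ^ g) +
        2 * K * (2 * K * (2 * R * n * Λ * θ ^ g) + R * (Λ * θ ^ g))
      = 4 * (K * R * 1 * Λ * θ ^ g) + 8 * (K ^ 2 * R * n * Λ * θ ^ g) := by ring
    _ ≤ 4 * (K ^ 2 * R * n * Λ * θ ^ g) + 8 * (K ^ 2 * R * n * Λ * θ ^ g) := by gcongr
    _ = 12 * (K ^ 2 * R * n * Λ * θ ^ g) := by ring
    _ ≤ _ := mul_le_gapError (by norm_num) (by positivity)

end Mixing

end WeakDepCLT

/-! ### The recurrence for the expected cosines -/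

namespace WeakDepCLT

variable {Ω : Type*} {mΩ : MeasurableSpace Ω}

namespace Mixing

variable {P : Measure Ω} [IsProbabilityMeasure P] {A v θ : ℝ} {X : ℝ → ℕ → Ω → ℝ}
  {F : ℕ → Filtration ℕ mΩ} {b : ℝ → ℕ → ℝ} {K R τ φ : ℝ} {n N g h w l : ℕ} {T ρ : Ω → ℝ}

/-- Lags up to 2g contribute `b K`, longer lags contribute nothing, and the diagonal enters with
weight 1/2. At most w + 1 errors accumulate. -/
lemma abs_integral_mul_window_sub_le (hX : Mixing P A v θ X F b) (hA : 1 ≤ A) (hv : 0 < v)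
    (hθ0 : 0 < θ) (hθ1 : θ < 1) (hK : 1 ≤ K) (hR : 1 ≤ R) (hgh : 2 * g ≤ h)
    (hj : ∀ j ≤ 2 * g, Real.exp (v * j) * θ ^ (h - j) ≤ θ ^ g)
    (hhl : h ≤ l) (hln : l < n) (hwl : w ≤ l) (hgw : 2 * g ≤ w)
    (hT : Approximable P (F n (l - h)) T R (2 * R * n * (A * (K * n) ^ v) * θ ^ g)) :
    |∫ ω, T ω * ((∑ j ∈ Finset.range w, X K (l - (j + 1)) ω) * X K l ω + X K l ω ^ 2 / 2) ∂P -
      (b K 0 / 2 + ∑ j ∈ Finset.range (2 * g), b K (j + 1)) * ∫ ω, T ω ∂P| ≤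
      (w + 1) * gapError A v θ K R n g := by
  have hTi := hT.integrable
  have i1 := fun i j => hX.integrable_mul_left₂ hK hTi i j
  have e1 : ∫ ω, T ω * ((∑ j ∈ Finset.range w, X K (l - (j + 1)) ω) * X K l ω +
      X K l ω ^ 2 / 2) ∂P = ∑ j ∈ Finset.range w, ∫ ω, T ω * (X K (l - (j + 1)) ω * X K l ω) ∂P +
      1 / 2 * ∫ ω, T ω * (X K (l - 0) ω * X K l ω) ∂P := by
    rw [← integral_finsetSum _ fun j _ => i1 _ _, ← integral_const_mul,
      ← integral_add (integrable_finsetSum _ fun j _ => i1 _ _) ((i1 _ _).const_mul _)]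
    refine integral_congr_ae (Eventually.of_forall fun ω => ?_)
    simp only [← Finset.mul_sum, ← Finset.sum_mul, Nat.sub_zero]
    ring
  have e2 : ∑ j ∈ Finset.range (2 * g), b K (j + 1) =
      ∑ j ∈ Finset.range w, if j < 2 * g then b K (j + 1) else 0 := by
    rw [← Finset.sum_filter]
    congr 1
    ext j
    simp only [Finset.mem_range, Finset.mem_filter]
    omega
  have e3 : ∑ j ∈ Finset.range w, ∫ ω, T ω * (X K (l - (j + 1)) ω * X K l ω) ∂P +
      1 / 2 * ∫ ω, T ω * (X K (l - 0) ω * X K l ω) ∂P -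
      (b K 0 / 2 + ∑ j ∈ Finset.range w, if j < 2 * g then b K (j + 1) else 0) * ∫ ω, T ω ∂P =
      ∑ j ∈ Finset.range w, (∫ ω, T ω * (X K (l - (j + 1)) ω * X K l ω) ∂P -
        (if j < 2 * g then b K (j + 1) else 0) * ∫ ω, T ω ∂P) +
      1 / 2 * (∫ ω, T ω * (X K (l - 0) ω * X K l ω) ∂P - b K 0 * ∫ ω, T ω ∂P) := by
    rw [Finset.sum_sub_distrib, ← Finset.sum_mul]
    ring
  rw [e1, e2, e3]
  have h0 := hX.abs_integral_mul_near_le hA hv hθ0 hK hR hhl hln hT (j := 0) (by omega)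
    (hj 0 (by omega))
  have h1 : ∀ j ∈ Finset.range w, |∫ ω, T ω * (X K (l - (j + 1)) ω * X K l ω) ∂P -
        (if j < 2 * g then b K (j + 1) else 0) * ∫ ω, T ω ∂P| ≤ gapError A v θ K R n g := by
    intro j hjw
    have hjw' := Finset.mem_range.1 hjw
    -- The index j stands for lag j + 1: the near case has lag at most 2g, the far case lag at least
    -- 2g + 1.
    split_ifs with hjg
    · exact hX.abs_integral_mul_near_le hA hv hθ0 hK hR hhl hln hT (by omega)
        (hj (j + 1) (by omega))
    · rw [zero_mul, sub_zero]
      exact hX.abs_integral_mul_far_le hA hv hθ0 hθ1 hK hR (by omega) hln hT (by omega) (by omega)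
  refine (abs_add_le _ _).trans ?_
  have h2 := (Finset.abs_sum_le_sum_abs _ _).trans (Finset.sum_le_sum h1)
  rw [Finset.sum_const, Finset.card_range, nsmul_eq_mul] at h2
  rw [abs_mul, abs_of_pos (by norm_num : (0 : ℝ) < 1 / 2)]
  have h3 := (abs_nonneg _).trans h0
  linarith

/-- Under the density `ρ`, the expectation of the cosine of a partial sum. -/
noncomputable def cosExpectation (P : Measure Ω) (Y : ℕ → Ω → ℝ) (ρ : Ω → ℝ) (τ φ : ℝ)
    (N l : ℕ) : ℝ :=
  ∫ ω, ρ ω * Real.cos (τ * ∑ i ∈ Finset.Ico N l, Y i ω + φ) ∂P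

omit [IsProbabilityMeasure P] in
lemma integrable_density_mul_cos (hX : Mixing P A v θ X F b) (hK : 1 ≤ K) (hρ : Integrable ρ P)
    (s : Finset ℕ) (τ φ : ℝ) :
    Integrable (fun ω => ρ ω * Real.cos (τ * ∑ i ∈ s, X K i ω + φ)) P :=
  hρ.mul_bdd (c := 1) (Real.measurable_cos.comp (((Finset.measurable_fun_sum s
      fun i _ => hX.measurable K hK i).const_mul τ).add_const φ)).aestronglyMeasurable
    (Eventually.of_forall fun ω => by
      rw [Real.norm_eq_abs]; exact Real.abs_cos_le_one _)

omit [IsProbabilityMeasure P] in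
lemma ae_abs_window_le (hX : Mixing P A v θ X F b) (hK : 1 ≤ K) (l w : ℕ) :
    ∀ᵐ ω ∂P, |∑ j ∈ Finset.range w, X K (l - (j + 1)) ω| ≤ 2 * K * w := by
  filter_upwards [ae_all_iff.2 (hX.bounded K hK)] with ω h
  refine (Finset.abs_sum_le_sum_abs _ _).trans ((Finset.sum_le_sum fun j _ => h _).trans ?_)
  rw [Finset.sum_const, Finset.card_range, nsmul_eq_mul, mul_comm]

omit [IsProbabilityMeasure P] in
lemma abs_cosExpectation_sub_le (hX : Mixing P A v θ X F b) (hK : 1 ≤ K) (hρ : Integrable ρ P)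
    (hρ0 : ∀ ω, 0 ≤ ρ ω) (hρ1 : ∫ ω, ρ ω ∂P = 1) (hNl : N + w ≤ l) (τ φ : ℝ) :
    |cosExpectation P (X K) ρ τ φ N (l - w) - cosExpectation P (X K) ρ τ φ N l| ≤
      |τ| * (2 * K * w) := by
  rw [cosExpectation, cosExpectation, ← integral_sub (hX.integrable_density_mul_cos hK hρ _ _ _)
    (hX.integrable_density_mul_cos hK hρ _ _ _)]
  refine abs_integral_le_integral_abs.trans ?_
  calc _ ≤ ∫ ω, ρ ω * (|τ| * (2 * K * w)) ∂P := by
        refine integral_mono_of_nonneg (Eventually.of_forall fun ω => abs_nonneg _)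
          (hρ.mul_const _) ?_
        filter_upwards [hX.ae_abs_window_le hK l w] with ω h
        rw [← mul_sub, abs_mul, abs_of_nonneg (hρ0 ω)]
        refine mul_le_mul_of_nonneg_left ?_ (hρ0 ω)
        refine (Real.abs_cos_sub_cos_le _ _).trans ?_
        rw [sum_Ico_eq_add_sum_window (fun i => X K i ω) w hNl]
        have e : ∀ S V : ℝ, τ * S + φ - (τ * (S + V) + φ) = -(τ * V) := fun S V => by ring
        rw [e, abs_neg, abs_mul]
        gcongr
    _ = _ := by rw [integral_mul_const, hρ1, one_mul]

/-- Only one of the three factors is bounded in supremum norm. The quadratic rest is kept for an L²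
estimate; bounding it too would cost two further powers of K. -/
lemma abs_remainder_le {τ V x K : ℝ} {w : ℕ} (hw : 1 ≤ w) (hx : |x| ≤ 2 * K)
    (hV : |V| ≤ 2 * K * w) :
    |τ * x| * (τ * V) ^ 2 + (τ * x) ^ 2 * |τ * V| + |τ * x| ^ 3 ≤
      |τ| ^ 3 * (2 * K * w) * (|V * x| + 2 * x ^ 2) := by
  have hw' : (1 : ℝ) ≤ w := by exact_mod_cast hw
  have hK : 0 ≤ K := by linarith [abs_nonneg x]
  have hx' : |x| ≤ 2 * K * w := hx.trans (le_mul_of_one_le_right (by linarith) hw')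
  have e : |τ * x| * (τ * V) ^ 2 + (τ * x) ^ 2 * |τ * V| + |τ * x| ^ 3 =
      |τ| ^ 3 * (|V| * |V * x| + |V| * x ^ 2 + |x| * x ^ 2) := by
    rw [← sq_abs (τ * V), ← sq_abs (τ * x), ← sq_abs x]
    simp only [abs_mul]
    ring
  rw [e, mul_assoc]
  refine mul_le_mul_of_nonneg_left ?_ (by positivity)
  have h1 := mul_le_mul_of_nonneg_right hV (abs_nonneg (V * x))
  have h2 := mul_le_mul_of_nonneg_right hV (sq_nonneg x)
  have h3 := mul_le_mul_of_nonneg_right hx' (sq_nonneg x)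
  linarith

lemma integral_density_remainder_le (hX : Mixing P A v θ X F b) (hA : 1 ≤ A) (hv : 0 < v)
    (hθ0 : 0 < θ) (hθ1 : θ < 1) (hK : 1 ≤ K) (hR : 1 ≤ R)
    (hρ : ∀ k < n, Approximable P (F n k) ρ R (R * θ ^ k)) (hρ0 : ∀ ω, 0 ≤ ρ ω)
    (hρ1 : ∫ ω, ρ ω ∂P = 1) (hNl : 2 * g + w ≤ l) (hln : l < n) :
    ∫ ω, ρ ω * (|(∑ j ∈ Finset.range w, X K (l - (j + 1)) ω) * X K l ω| + 2 * X K l ω ^ 2) ∂P ≤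
      (w + 2) * (|b K 0| + gapError A v θ K R n g) := by
  have hρi := (hρ l hln).integrable
  set E := |b K 0| + gapError A v θ K R n g with hE
  have i2 : ∀ i, Integrable (fun ω => ρ ω * X K i ω ^ 2) P := fun i => by
    simpa only [sq] using hX.integrable_mul_left₂ hK hρi i i
  have hb : ∀ i, 2 * g ≤ i → i < n → ∫ ω, ρ ω * X K i ω ^ 2 ∂P ≤ E := fun i h1 h2 =>
    hX.integral_density_mul_sq_le hA hv hθ0 hθ1 hK hR hρ hρ1 h1 h2
  have i3 : ∀ j, Integrable (fun ω => 1 / 2 * (ρ ω * X K (l - (j + 1)) ω ^ 2) +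
      1 / 2 * (ρ ω * X K l ω ^ 2)) P := fun j => ((i2 _).const_mul _).add ((i2 l).const_mul _)
  have i4 : Integrable (fun ω => 2 * (ρ ω * X K l ω ^ 2)) P := (i2 l).const_mul 2
  calc _ ≤ ∫ ω, ((∑ j ∈ Finset.range w, (1 / 2 * (ρ ω * X K (l - (j + 1)) ω ^ 2) +
        1 / 2 * (ρ ω * X K l ω ^ 2))) + 2 * (ρ ω * X K l ω ^ 2)) ∂P := by
        refine integral_mono_of_nonneg (Eventually.of_forall fun ω =>
          mul_nonneg (hρ0 ω) (by positivity)) ((integrable_finsetSum _ fun j _ => i3 j).add i4)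
          (Eventually.of_forall fun ω => ?_)
        simp only
        have h1 : |(∑ j ∈ Finset.range w, X K (l - (j + 1)) ω) * X K l ω| ≤
            ∑ j ∈ Finset.range w, (1 / 2 * X K (l - (j + 1)) ω ^ 2 + 1 / 2 * X K l ω ^ 2) := by
          rw [Finset.sum_mul]
          refine (Finset.abs_sum_le_sum_abs _ _).trans (Finset.sum_le_sum fun j _ => ?_)
          rw [abs_le]
          constructor
          · nlinarith [sq_nonneg (X K (l - (j + 1)) ω + X K l ω)]
          · nlinarith [sq_nonneg (X K (l - (j + 1)) ω - X K l ω)]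
        have h2 := mul_le_mul_of_nonneg_left h1 (hρ0 ω)
        rw [Finset.mul_sum] at h2
        rw [mul_add]
        refine add_le_add (h2.trans (le_of_eq (Finset.sum_congr rfl fun j _ => by ring)))
          (le_of_eq (by ring))
    _ = ∑ j ∈ Finset.range w, (1 / 2 * ∫ ω, ρ ω * X K (l - (j + 1)) ω ^ 2 ∂P +
          1 / 2 * ∫ ω, ρ ω * X K l ω ^ 2 ∂P) + 2 * ∫ ω, ρ ω * X K l ω ^ 2 ∂P := by
        rw [integral_add (integrable_finsetSum _ fun j _ => i3 j) i4,
          integral_finsetSum _ fun j _ => i3 j, integral_const_mul]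
        congr 1
        refine Finset.sum_congr rfl fun j _ => ?_
        rw [integral_add ((i2 _).const_mul _) ((i2 l).const_mul _), integral_const_mul,
          integral_const_mul]
    _ ≤ ∑ j ∈ Finset.range w, (1 / 2 * E + 1 / 2 * E) + 2 * E := by
        have hl := hb l (by omega) hln
        refine add_le_add (Finset.sum_le_sum fun j hj => ?_) (by linarith)
        have := Finset.mem_range.1 hj
        have := hb (l - (j + 1)) (by omega) (by omega)
        linarith
    _ = _ := by
        rw [Finset.sum_const, Finset.card_range, nsmul_eq_mul]; ring

/-- The approximate recurrence satisfied by the expectations of the cosines. -/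
theorem abs_cosExpectation_succ_sub_le (hX : Mixing P A v θ X F b) (hA : 1 ≤ A) (hv : 0 < v)
    (hθ0 : 0 < θ) (hθ1 : θ < 1) (hK : 1 ≤ K) (hR : 1 ≤ R) (hτ : |τ| ≤ 1)
    (hρ : ∀ k < n, Approximable P (F n k) ρ R (R * θ ^ k)) (hρ0 : ∀ ω, 0 ≤ ρ ω)
    (hρ1 : ∫ ω, ρ ω ∂P = 1) (hg : 1 ≤ g) (hgh : 2 * g ≤ h)
    (hj : ∀ j ≤ 2 * g, Real.exp (v * j) * θ ^ (h - j) ≤ θ ^ g) (hw : w = h + g)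
    (hτw : |τ| * (2 * K * w) ≤ 1) (hgN : 2 * g ≤ N) (hNl : N + w ≤ l) (hln : l < n) (φ : ℝ) :
    |cosExpectation P (X K) ρ τ φ N (l + 1) - (1 - τ ^ 2 * (b K 0 / 2 +
        ∑ j ∈ Finset.range (2 * g), b K (j + 1))) * cosExpectation P (X K) ρ τ φ N l| ≤
      |τ| * gapError A v θ K R n g + τ ^ 2 * ((w + 1) * gapError A v θ K R n g) +
      |τ| ^ 3 * (2 * K * w) * ((w + 2) * (|b K 0| + gapError A v θ K R n g)) +
      τ ^ 2 * |b K 0 / 2 + ∑ j ∈ Finset.range (2 * g), b K (j + 1)| * (|τ| * (2 * K * w)) := by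
  have hρi := (hρ l hln).integrable
  have hw1 : 1 ≤ w := by omega
  set β := b K 0 / 2 + ∑ j ∈ Finset.range (2 * g), b K (j + 1) with hβ
  set Ψ := gapError A v θ K R n g with hΨ
  -- Since w = h + g, the history stops g steps before time l - h and a gap h remains until l. The
  -- phase ψ is φ for the quadratic term and φ + π/2 for the linear one.
  have hTapp := fun ψ : ℝ => hX.approximable_density_mul_cos (N := N) (g := g) (a := l - w) (m := l - h)
    hA hv hθ0 hθ1 hK hR hτ hρ (by omega) (by omega) ψ
  set T : ℝ → Ω → ℝ := fun ψ ω => ρ ω * Real.cos (τ * ∑ i ∈ Finset.Ico N (l - w), X K i ω + ψ)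
    with hTdef
  set V : Ω → ℝ := fun ω => ∑ j ∈ Finset.range w, X K (l - (j + 1)) ω with hV
  have hTi : ∀ ψ, Integrable (T ψ) P := fun ψ => (hTapp ψ).integrable
  have d1 : |∫ ω, T (φ + Real.pi / 2) ω * X K l ω ∂P| ≤ Ψ :=
    hX.abs_integral_mul_le_gapError hA hv hθ0 hθ1 hK hR (h := h) (by omega) (by omega) hln (hTapp _)
  have d2 : |∫ ω, T φ ω * (V ω * X K l ω + X K l ω ^ 2 / 2) ∂P - β * ∫ ω, T φ ω ∂P| ≤
      (w + 1) * Ψ :=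
    hX.abs_integral_mul_window_sub_le hA hv hθ0 hθ1 hK hR hgh hj (by omega) hln (by omega)
      (by omega) (hTapp φ)
  have d3 : ∫ ω, ρ ω * (|V ω * X K l ω| + 2 * X K l ω ^ 2) ∂P ≤ (w + 2) * (|b K 0| + Ψ) :=
    hX.integral_density_remainder_le hA hv hθ0 hθ1 hK hR hρ hρ0 hρ1 (by omega) hln
  have d4 := hX.abs_cosExpectation_sub_le hK hρi hρ0 hρ1 hNl τ φ
  have c0 : cosExpectation P (X K) ρ τ φ N (l - w) = ∫ ω, T φ ω ∂P := rfl
  have iV : ∀ ψ, Integrable (fun ω => T ψ ω * (V ω * X K l ω + X K l ω ^ 2 / 2)) P := fun ψ => by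
    have i1 : Integrable (fun ω => ∑ j ∈ Finset.range w,
        T ψ ω * (X K (l - (j + 1)) ω * X K l ω) + 1 / 2 * (T ψ ω * (X K l ω * X K l ω))) P :=
      (integrable_finsetSum _ fun j _ => hX.integrable_mul_left₂ hK (hTi ψ) _ _).add
        ((hX.integrable_mul_left₂ hK (hTi ψ) l l).const_mul _)
    refine i1.congr (Eventually.of_forall fun ω => ?_)
    simp only [hV, ← Finset.mul_sum, ← Finset.sum_mul]
    ring
  have iM : Integrable (fun ω => τ * (T (φ + Real.pi / 2) ω * X K l ω) -
      τ ^ 2 * (T φ ω * (V ω * X K l ω + X K l ω ^ 2 / 2))) P :=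
    ((hX.integrable_mul_left hK (hTi _) l).const_mul _).sub ((iV φ).const_mul _)
  have iR : Integrable (fun ω => ρ ω * (|V ω * X K l ω| + 2 * X K l ω ^ 2)) P := by
    refine hρi.mul_bdd (c := 2 * K * w * (2 * K) + 2 * (2 * K) ^ 2) ?_ ?_
    · have hVm : Measurable V := Finset.measurable_fun_sum _ fun j _ => hX.measurable K hK _
      exact ((hVm.mul (hX.measurable K hK l)).abs.add
        (((hX.measurable K hK l).pow_const 2).const_mul 2)).aestronglyMeasurable
    · filter_upwards [hX.bounded K hK l, hX.ae_abs_window_le hK l w] with ω h1 h2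
      rw [Real.norm_eq_abs, abs_of_nonneg (by positivity), abs_mul, ← sq_abs (X K l ω)]
      gcongr
  have hdiff : |(cosExpectation P (X K) ρ τ φ N (l + 1) - cosExpectation P (X K) ρ τ φ N l) -
      (τ * ∫ ω, T (φ + Real.pi / 2) ω * X K l ω ∂P -
        τ ^ 2 * ∫ ω, T φ ω * (V ω * X K l ω + X K l ω ^ 2 / 2) ∂P)| ≤
      |τ| ^ 3 * (2 * K * w) * ((w + 2) * (|b K 0| + Ψ)) := by
    have j1 := hX.integrable_density_mul_cos hK hρi (Finset.Ico N (l + 1)) τ φ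
    have j2 := hX.integrable_density_mul_cos hK hρi (Finset.Ico N l) τ φ
    have j3 : Integrable (fun ω => ρ ω * Real.cos (τ * ∑ i ∈ Finset.Ico N (l + 1), X K i ω + φ) -
        ρ ω * Real.cos (τ * ∑ i ∈ Finset.Ico N l, X K i ω + φ)) P := j1.sub j2
    rw [cosExpectation, cosExpectation, ← integral_sub j1 j2, ← integral_const_mul,
      ← integral_const_mul, ← integral_sub ((hX.integrable_mul_left hK (hTi _) l).const_mul _)
        ((iV φ).const_mul _), ← integral_sub j3 iM]
    refine abs_integral_le_integral_abs.trans ?_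
    calc _ ≤ ∫ ω, |τ| ^ 3 * (2 * K * w) * (ρ ω * (|V ω * X K l ω| + 2 * X K l ω ^ 2)) ∂P := by
          refine integral_mono_of_nonneg (Eventually.of_forall fun ω => abs_nonneg _)
            (iR.const_mul _) ?_
          filter_upwards [hX.bounded K hK l, hX.ae_abs_window_le hK l w] with ω h1 h2
          have hVb : |τ * V ω| ≤ 1 := by
            rw [abs_mul]
            exact (mul_le_mul_of_nonneg_left h2 (abs_nonneg _)).trans hτw
          have hxb : |τ * X K l ω| ≤ 1 := by
            rw [abs_mul]
            refine (mul_le_mul_of_nonneg_left (h1.trans ?_) (abs_nonneg _)).trans hτw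
            exact le_mul_of_one_le_right (by linarith) (by exact_mod_cast hw1)
          have key := (abs_cos_increment_le (τ * ∑ i ∈ Finset.Ico N (l - w), X K i ω + φ)
            hVb hxb).trans (abs_remainder_le hw1 h1 h2)
          have key2 := mul_le_mul_of_nonneg_left key (hρ0 ω)
          rw [← abs_of_nonneg (hρ0 ω), ← abs_mul, abs_of_nonneg (hρ0 ω)] at key2
          rw [Finset.sum_Ico_succ_top (by omega : N ≤ l),
            sum_Ico_eq_add_sum_window (fun i => X K i ω) w hNl]
          refine (le_of_eq ?_).trans (key2.trans (le_of_eq (by ring)))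
          congr 1
          simp only [hTdef, hV]
          have a1 : ∀ S W x : ℝ, τ * (S + W + x) + φ = τ * S + φ + τ * W + τ * x :=
            fun S W x => by ring
          have a2 : ∀ S W : ℝ, τ * (S + W) + φ = τ * S + φ + τ * W := fun S W => by ring
          rw [a1, a2, ← add_assoc]
          ring
      _ = |τ| ^ 3 * (2 * K * w) * ∫ ω, ρ ω * (|V ω * X K l ω| + 2 * X K l ω ^ 2) ∂P :=
          integral_const_mul _ _
      _ ≤ _ := by gcongr
  rw [c0] at d4
  set fl := cosExpectation P (X K) ρ τ φ N l with hfl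
  set fs := cosExpectation P (X K) ρ τ φ N (l + 1) with hfs
  set I1 := ∫ ω, T (φ + Real.pi / 2) ω * X K l ω ∂P with hI1
  set I2 := ∫ ω, T φ ω * (V ω * X K l ω + X K l ω ^ 2 / 2) ∂P with hI2
  set I0 := ∫ ω, T φ ω ∂P with hI0
  -- The error splits into the Taylor remainder, the linear term, the decoupling of the covariances,
  -- and the reinsertion of the window in the cosine so that the recurrence closes on f(l).
  have e : fs - (1 - τ ^ 2 * β) * fl = ((fs - fl) - (τ * I1 - τ ^ 2 * I2)) + τ * I1 +
      -(τ ^ 2 * (I2 - β * I0)) + -(τ ^ 2 * β * (I0 - fl)) := by ring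
  rw [e]
  have t1 : |τ * I1| ≤ |τ| * Ψ := by rw [abs_mul]; gcongr
  have t2 : |-(τ ^ 2 * (I2 - β * I0))| ≤ τ ^ 2 * ((w + 1) * Ψ) := by
    rw [abs_neg, abs_mul, abs_of_nonneg (sq_nonneg τ)]; gcongr
  have t3 : |-(τ ^ 2 * β * (I0 - fl))| ≤ τ ^ 2 * |β| * (|τ| * (2 * K * w)) := by
    rw [abs_neg, abs_mul, abs_mul, abs_of_nonneg (sq_nonneg τ)]; gcongr
  refine (abs_add_le _ _).trans ((add_le_add (abs_add_three _ _ _) le_rfl).trans ?_)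
  linarith

end Mixing

end WeakDepCLT

/-! ### Asymptotics of the parameters and solution of the recurrence -/

namespace WeakDepCLT

lemma tendsto_natCast_rpow_of_neg {p : ℝ} (hp : p < 0) :
    Tendsto (fun n : ℕ => (n : ℝ) ^ p) atTop (𝓝 0) := by
  have h := (tendsto_rpow_neg_atTop (y := -p) (by linarith)).comp
    (tendsto_natCast_atTop_atTop (R := ℝ))
  rw [neg_neg] at h
  exact h

lemma tendsto_rpow_mul_pow_floor {θ κ : ℝ} (hθ0 : 0 < θ) (hθ1 : θ < 1) (hκ : 0 < κ) (p : ℝ) :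
    Tendsto (fun n : ℕ => (n : ℝ) ^ p * θ ^ ⌊(n : ℝ) ^ κ⌋₊) atTop (𝓝 0) := by
  have hl : 0 < -Real.log θ := neg_pos.2 (Real.log_neg hθ0 hθ1)
  have h1 : Tendsto (fun n : ℕ => (n : ℝ) ^ κ) atTop atTop :=
    (tendsto_rpow_atTop hκ).comp (tendsto_natCast_atTop_atTop (R := ℝ))
  have h2 := ((tendsto_rpow_mul_exp_neg_mul_atTop_nhds_zero (p / κ) _ hl).comp h1).const_mul θ⁻¹
  rw [mul_zero] at h2
  refine squeeze_zero (fun n => by positivity) (fun n => ?_) h2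
  simp only [Function.comp]
  have hn : (0 : ℝ) ≤ n := Nat.cast_nonneg n
  have e1 : ((n : ℝ) ^ κ) ^ (p / κ) = (n : ℝ) ^ p := by
    rw [← Real.rpow_mul hn]; congr 1; field_simp
  have e2 : θ⁻¹ * Real.exp (-(-Real.log θ) * (n : ℝ) ^ κ) = θ ^ ((n : ℝ) ^ κ - 1) := by
    rw [Real.rpow_sub hθ0, Real.rpow_one, Real.rpow_def_of_pos hθ0, neg_neg]
    field_simp
  rw [e1, mul_left_comm, e2]
  refine mul_le_mul_of_nonneg_left ?_ (by positivity)
  rw [← Real.rpow_natCast]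
  refine Real.rpow_le_rpow_of_exponent_ge hθ0 hθ1.le ?_
  linarith [(Nat.lt_floor_add_one ((n : ℝ) ^ κ)).le]

/-- With |q| ≤ 1 past errors are never amplified, so they simply add. -/
lemma abs_sub_pow_mul_le {f : ℕ → ℝ} {q e : ℝ} {L n : ℕ} (hq : |q| ≤ 1) (he : 0 ≤ e)
    (hLn : L ≤ n) (h : ∀ l, L ≤ l → l < n → |f (l + 1) - q * f l| ≤ e) :
    |f n - q ^ (n - L) * f L| ≤ n * e := by
  have key : ∀ m, L + m ≤ n → |f (L + m) - q ^ m * f L| ≤ m * e := by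
    intro m
    induction m with
    | zero => simp
    | succ m ih =>
      intro hm
      have h1 := ih (by omega)
      have h2 := h (L + m) (by omega) (by omega)
      have e1 : f (L + (m + 1)) - q ^ (m + 1) * f L =
          (f (L + m + 1) - q * f (L + m)) + q * (f (L + m) - q ^ m * f L) := by
        rw [← add_assoc]; ring
      rw [e1]
      refine (abs_add_le _ _).trans ?_
      rw [abs_mul]
      have h3 := mul_le_mul hq h1 (abs_nonneg _) zero_le_one
      push_cast
      linarith
  have h4 := key (n - L) (by omega)
  rw [Nat.add_sub_cancel' hLn] at h4
  refine h4.trans ?_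
  gcongr
  omega

/-- Dropping L = o(n) factors is harmless: Bernoulli's inequality bounds their product below by 1 -
L x / n. -/
lemma tendsto_one_sub_div_pow_sub {x : ℕ → ℝ} {y : ℝ} {L : ℕ → ℕ} (hx : Tendsto x atTop (𝓝 y))
    (hx0 : ∀ᶠ n in atTop, 0 ≤ x n) (hL : Tendsto (fun n => (L n : ℝ) / n) atTop (𝓝 0)) :
    Tendsto (fun n => (1 - x n / n) ^ (n - L n)) atTop (𝓝 (Real.exp (-y))) := by
  have h1 : Tendsto (fun n : ℕ => (1 + -(x n / n)) ^ n) atTop (𝓝 (Real.exp (-y))) := by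
    refine Real.tendsto_one_add_pow_exp_of_tendsto ?_
    refine hx.neg.congr' ?_
    filter_upwards [eventually_ge_atTop 1] with n hn
    have : (n : ℝ) ≠ 0 := by positivity
    field_simp
  have hxn : Tendsto (fun n : ℕ => x n / n) atTop (𝓝 0) := hx.div_atTop tendsto_natCast_atTop_atTop
  have hsmall : ∀ᶠ n in atTop, x n / n < 1 := hxn.eventually (gt_mem_nhds one_pos)
  have hLn : ∀ᶠ n in atTop, L n ≤ n := by
    filter_upwards [hL.eventually (gt_mem_nhds one_pos), eventually_ge_atTop 1] with n h hn
    rw [div_lt_one (by positivity)] at h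
    exact_mod_cast h.le
  have h2 : Tendsto (fun n : ℕ => (1 + -(x n / n)) ^ L n) atTop (𝓝 1) := by
    have h3 : Tendsto (fun n : ℕ => 1 + (L n : ℝ) * -(x n / n)) atTop (𝓝 1) := by
      have := (hL.mul hx).neg.const_add 1
      simp only [zero_mul, neg_zero, add_zero] at this
      refine this.congr fun n => ?_
      ring
    refine tendsto_of_tendsto_of_tendsto_of_le_of_le' h3 tendsto_const_nhds ?_ ?_
    · filter_upwards [hsmall] with n h
      exact one_add_mul_le_pow (by linarith) _
    · filter_upwards [hsmall, hx0] with n h h0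
      have : 0 ≤ x n / n := by positivity
      exact pow_le_one₀ (by linarith) (by linarith)
  have h4 := h1.div h2 one_ne_zero
  rw [div_one] at h4
  refine h4.congr' ?_
  filter_upwards [hsmall, hLn] with n h hl
  have hne : (1 + -(x n / n)) ≠ 0 := by linarith
  simp only [Pi.div_apply]
  rw [← sub_eq_add_neg] at hne ⊢
  rw [pow_sub₀ _ hne hl]
  rfl

/-- The quantity `w ^ 2 K / √n`, with windows `w` of length `n ^ κ`, tends to zero. -/
lemma tendsto_level_mul_window {α κ : ℝ} (hακ : α + 2 * κ < 1 / 2) (hκ : 0 < κ) (m : ℕ) :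
    Tendsto (fun n : ℕ => (n : ℝ) ^ α * ((m * ⌊(n : ℝ) ^ κ⌋₊ : ℕ) : ℝ) *
      (((m * ⌊(n : ℝ) ^ κ⌋₊ : ℕ) : ℝ) + 2) / √(n : ℝ)) atTop (𝓝 0) := by
  have h := (tendsto_natCast_rpow_of_neg (p := α + 2 * κ - 1 / 2) (by linarith)).const_mul
    ((m : ℝ) * (m + 2))
  rw [mul_zero] at h
  refine squeeze_zero' (Eventually.of_forall fun n => by positivity) ?_ h
  filter_upwards [eventually_ge_atTop 1] with n hn
  have hn' : (1 : ℝ) ≤ n := by exact_mod_cast hn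
  have hn0 : (0 : ℝ) < n := by linarith
  have hf : (⌊(n : ℝ) ^ κ⌋₊ : ℝ) ≤ (n : ℝ) ^ κ := Nat.floor_le (by positivity)
  have h1 : 1 ≤ (n : ℝ) ^ κ := Real.one_le_rpow hn' hκ.le
  push_cast
  calc (n : ℝ) ^ α * (m * ⌊(n : ℝ) ^ κ⌋₊) * (m * ⌊(n : ℝ) ^ κ⌋₊ + 2) / √(n : ℝ)
      ≤ (n : ℝ) ^ α * (m * (n : ℝ) ^ κ) * (m * (n : ℝ) ^ κ + 2 * (n : ℝ) ^ κ) / √(n : ℝ) := by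
        gcongr; linarith
    _ = (m : ℝ) * (m + 2) * ((n : ℝ) ^ α * ((n : ℝ) ^ κ * (n : ℝ) ^ κ) / √(n : ℝ)) := by ring
    _ = _ := by
        rw [Real.sqrt_eq_rpow, ← Real.rpow_add hn0, ← Real.rpow_add hn0, ← Real.rpow_sub hn0]
        congr 2; ring

/-- Replacing each b_{K,j} by its limit costs O(K^(-δ)), and there are O(n^κ) lags; κ < αδ makes the
total vanish. -/
lemma tendsto_covLimit_partial_sum {b : ℝ → ℕ → ℝ} {σ : ℕ → ℝ} {D δ α κ : ℝ}
    (hα : 0 < α) (hκ : 0 < κ) (hκδ : κ < α * δ)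
    (hb : ∀ K : ℝ, 1 ≤ K → ∀ j, |b K j - σ j| ≤ D * K ^ (-δ)) (hσ : Summable σ) :
    Tendsto (fun n : ℕ => b ((n : ℝ) ^ α) 0 / 2 +
      ∑ j ∈ Finset.range (2 * ⌊(n : ℝ) ^ κ⌋₊), b ((n : ℝ) ^ α) (j + 1)) atTop
      (𝓝 (σ 0 / 2 + ∑' j, σ (j + 1))) := by
  have hD : 0 ≤ D := by
    have := (abs_nonneg _).trans (hb 1 le_rfl 0)
    simpa using this
  have hfl : Tendsto (fun n : ℕ => 2 * ⌊(n : ℝ) ^ κ⌋₊) atTop atTop :=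
    Tendsto.const_mul_atTop' two_pos (tendsto_nat_floor_atTop.comp
      ((tendsto_rpow_atTop hκ).comp (tendsto_natCast_atTop_atTop (R := ℝ))))
  have h1 : Tendsto (fun n : ℕ => σ 0 / 2 +
      ∑ j ∈ Finset.range (2 * ⌊(n : ℝ) ^ κ⌋₊), σ (j + 1)) atTop
      (𝓝 (σ 0 / 2 + ∑' j, σ (j + 1))) :=
    (((summable_nat_add_iff 1).2 hσ).hasSum.tendsto_sum_nat.comp hfl).const_add _
  have h2 : Tendsto (fun n : ℕ => D * 3 * (n : ℝ) ^ (κ - α * δ)) atTop (𝓝 0) := by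
    simpa using (tendsto_natCast_rpow_of_neg (p := κ - α * δ) (by linarith)).const_mul (D * 3)
  refine (tendsto_of_tendsto_of_dist h1 (squeeze_zero' (Eventually.of_forall fun n => dist_nonneg)
    ?_ h2))
  filter_upwards [eventually_ge_atTop 1] with n hn
  have hn' : (1 : ℝ) ≤ n := by exact_mod_cast hn
  have hn0 : (0 : ℝ) < n := by linarith
  have hK : 1 ≤ (n : ℝ) ^ α := Real.one_le_rpow hn' hα.le
  have hf : (⌊(n : ℝ) ^ κ⌋₊ : ℝ) ≤ (n : ℝ) ^ κ := Nat.floor_le (by positivity)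
  have h1 : 1 ≤ (n : ℝ) ^ κ := Real.one_le_rpow hn' hκ.le
  set K := (n : ℝ) ^ α with hKd
  set E := D * K ^ (-δ) with hE
  have hE0 : 0 ≤ E := by positivity
  have h3 : |∑ j ∈ Finset.range (2 * ⌊(n : ℝ) ^ κ⌋₊), (σ (j + 1) - b K (j + 1))| ≤
      (2 * ⌊(n : ℝ) ^ κ⌋₊ : ℕ) * E := by
    refine (Finset.abs_sum_le_sum_abs _ _).trans ((Finset.sum_le_sum fun j _ => ?_).trans
      (le_of_eq (by rw [Finset.sum_const, Finset.card_range, nsmul_eq_mul])))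
    rw [abs_sub_comm]
    exact hb K hK (j + 1)
  have h0 := hb K hK 0
  rw [abs_sub_comm] at h0
  rw [Real.dist_eq]
  have e : σ 0 / 2 + ∑ j ∈ Finset.range (2 * ⌊(n : ℝ) ^ κ⌋₊), σ (j + 1) -
      (b K 0 / 2 + ∑ j ∈ Finset.range (2 * ⌊(n : ℝ) ^ κ⌋₊), b K (j + 1)) =
      1 / 2 * (σ 0 - b K 0) +
        ∑ j ∈ Finset.range (2 * ⌊(n : ℝ) ^ κ⌋₊), (σ (j + 1) - b K (j + 1)) := by
    rw [Finset.sum_sub_distrib]; ring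
  rw [e]
  refine (abs_add_le _ _).trans ?_
  rw [abs_mul, abs_of_pos (by norm_num : (0 : ℝ) < 1 / 2)]
  push_cast at h3
  calc 1 / 2 * |σ 0 - b K 0| + _ ≤ 1 * E + 2 * ⌊(n : ℝ) ^ κ⌋₊ * E := by linarith
    _ ≤ (n : ℝ) ^ κ * E + 2 * (n : ℝ) ^ κ * E := by gcongr
    _ = D * 3 * ((n : ℝ) ^ κ * K ^ (-δ)) := by rw [hE]; ring
    _ = _ := by
      rw [hKd, ← Real.rpow_mul hn0.le, ← Real.rpow_add hn0]
      congr 2; ring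

/-- A gap of length n^κ makes the error smaller than any power of n, so all polynomial factors,
including the size of the densities, are harmless. -/
lemma tendsto_gapError {A v θ α κ c d : ℝ} (hθ0 : 0 < θ) (hθ1 : θ < 1) (hκ : 0 < κ) (p : ℝ) :
    Tendsto (fun n : ℕ => (n : ℝ) ^ p *
      gapError A v θ ((n : ℝ) ^ α) (c * (n : ℝ) ^ d) n ⌊(n : ℝ) ^ κ⌋₊) atTop (𝓝 0) := by
  have h := (tendsto_rpow_mul_pow_floor hθ0 hθ1 hκ (p + 2 * α + d + 1 + α * v + v)).const_mul
    (17 * c * A)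
  rw [mul_zero] at h
  refine h.congr' ?_
  filter_upwards [eventually_ge_atTop 1] with n hn
  have hn0 : (0 : ℝ) < n := by exact_mod_cast hn
  have e1 : ((n : ℝ) ^ α) ^ 2 = (n : ℝ) ^ (2 * α) := by
    rw [← Real.rpow_natCast, ← Real.rpow_mul hn0.le]; congr 1; push_cast; ring
  have e2 : ((n : ℝ) ^ α * n) ^ v = (n : ℝ) ^ (α * v) * (n : ℝ) ^ v := by
    rw [Real.mul_rpow (by positivity) hn0.le, ← Real.rpow_mul hn0.le]
  rw [gapError, e1, e2]
  simp only [Real.rpow_add hn0, Real.rpow_one]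
  ring

variable {Ω : Type*} {mΩ : MeasurableSpace Ω}

set_option maxHeartbeats 800000 in
/-- The central limit theorem for the truncated variables, under the densities `ρ n`, in terms of
the expectations of the cosines of the normalized sums. -/
theorem Mixing.tendsto_cosExpectation {P : Measure Ω} [IsProbabilityMeasure P] {A v θ : ℝ}
    {X : ℝ → ℕ → Ω → ℝ} {F : ℕ → Filtration ℕ mΩ} {b : ℝ → ℕ → ℝ}
    (hX : Mixing P A v θ X F b) (hA : 1 ≤ A) (hv : 0 < v) (hθ0 : 0 < θ) (hθ1 : θ < 1)
    {σj : ℕ → ℝ} {D δ σ α ε c d : ℝ} (hδ : 0 < δ)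
    (hb : ∀ K : ℝ, 1 ≤ K → ∀ j, |b K j - σj j| ≤ D * K ^ (-δ)) (hσj : Summable σj)
    (hσ : 0 < σ) (hσ2 : σ ^ 2 = σj 0 + 2 * ∑' j : ℕ, σj (j + 1))
    (hα : 0 < α) (hε : 0 < ε) (hαε : α + ε < 1 / 2) (hc : 1 ≤ c) (hd : 0 ≤ d)
    {ρ : ℕ → Ω → ℝ} (hρ : ∀ n : ℕ, 1 ≤ n → ∀ k < n,
      Approximable P (F n k) (ρ n) (c * (n : ℝ) ^ d) (c * (n : ℝ) ^ d * θ ^ k))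
    (hρ0 : ∀ n ω, 0 ≤ ρ n ω) (hρ1 : ∀ n, ∫ ω, ρ n ω ∂P = 1) (t φ : ℝ) :
    Tendsto (fun n : ℕ => cosExpectation P (X ((n : ℝ) ^ α)) (ρ n) (t / (σ * √(n : ℝ))) φ
      ⌈(n : ℝ) ^ ε⌉₊ n) atTop (𝓝 (Real.cos φ * Real.exp (-(t ^ 2 / 2)))) := by
  -- The bound κ ≤ ε/2 gives α + 2κ < 1/2 and places the start n^ε beyond 2g; κ < αδ makes the
  -- covariance sums converge.
  set κ := min (ε / 2) (α * δ / 2) with hκd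
  have hκ : 0 < κ := lt_min (by positivity) (by positivity)
  have hκε : κ ≤ ε / 2 := min_le_left _ _
  have hκδ : κ < α * δ := (min_le_right _ _).trans_lt (by linarith [mul_pos hα hδ])
  -- With h = 2(M+1)g and j ≤ 2g one has h - j ≥ Mg, so θ^(h-j) pays for exp(vj) ≤ exp(2vg) and
  -- leaves θ^g. The window w = h + g is then mg.
  obtain ⟨M, hM⟩ := exists_pow_lt_of_lt_one (by positivity : 0 < θ * Real.exp (-(2 * v))) hθ1
  set g : ℕ → ℕ := fun n => ⌊(n : ℝ) ^ κ⌋₊ with hg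
  set m := 2 * (M + 1) + 1 with hm
  set w : ℕ → ℕ := fun n => m * g n with hw
  set N : ℕ → ℕ := fun n => ⌈(n : ℝ) ^ ε⌉₊ with hN
  set L : ℕ → ℕ := fun n => N n + w n with hL
  set Ψ : ℕ → ℝ := fun n => gapError A v θ ((n : ℝ) ^ α) (c * (n : ℝ) ^ d) n (g n) with hΨ
  set β : ℕ → ℝ := fun n => b ((n : ℝ) ^ α) 0 / 2 +
    ∑ j ∈ Finset.range (2 * g n), b ((n : ℝ) ^ α) (j + 1) with hβ
  set τ : ℕ → ℝ := fun n => t / (σ * √(n : ℝ)) with hτ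
  set s₀ := |t| / σ with hs₀
  have hτabs : ∀ n, |τ n| = s₀ / √(n : ℝ) := fun n => by
    simp only [hτ, hs₀]
    rw [abs_div, abs_mul, abs_of_pos hσ, abs_of_nonneg (Real.sqrt_nonneg _), div_div]
  have lim_Kw2 : Tendsto (fun n : ℕ => (n : ℝ) ^ α * (w n : ℝ) * ((w n : ℝ) + 2) / √(n : ℝ))
      atTop (𝓝 0) := tendsto_level_mul_window (by linarith) hκ m
  have lim_Kw : Tendsto (fun n : ℕ => (n : ℝ) ^ α * (w n : ℝ) / √(n : ℝ)) atTop (𝓝 0) := by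
    refine squeeze_zero (fun n => by positivity) (fun n => ?_) lim_Kw2
    refine div_le_div_of_nonneg_right ?_ (Real.sqrt_nonneg _)
    exact le_mul_of_one_le_right (by positivity) (by linarith [Nat.cast_nonneg (α := ℝ) (w n)])
  have lim_β : Tendsto β atTop (𝓝 (σ ^ 2 / 2)) := by
    have := tendsto_covLimit_partial_sum hα hκ hκδ hb hσj
    convert this using 2
    rw [hσ2]; ring
  have lim_b0 : Tendsto (fun n : ℕ => b ((n : ℝ) ^ α) 0) atTop (𝓝 (σj 0)) := by
    have h1 : Tendsto (fun n : ℕ => D * (n : ℝ) ^ (-(α * δ))) atTop (𝓝 0) := by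
      simpa using (tendsto_natCast_rpow_of_neg (p := -(α * δ))
        (by linarith [mul_pos hα hδ])).const_mul D
    rw [tendsto_iff_norm_sub_tendsto_zero]
    refine squeeze_zero' (Eventually.of_forall fun n => norm_nonneg _) ?_ h1
    filter_upwards [eventually_ge_atTop 1] with n hn
    have hn' : (1 : ℝ) ≤ n := by exact_mod_cast hn
    have := hb _ (Real.one_le_rpow hn' hα.le) 0
    rw [← Real.rpow_mul (by linarith)] at this
    rw [Real.norm_eq_abs]
    refine this.trans (le_of_eq ?_)
    congr 2; ring
  have lim_Ψ : ∀ p : ℝ, Tendsto (fun n : ℕ => (n : ℝ) ^ p * Ψ n) atTop (𝓝 0) :=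
    tendsto_gapError hθ0 hθ1 hκ
  have lim_Ψ0 : Tendsto Ψ atTop (𝓝 0) := by simpa using lim_Ψ 0
  have hpow : ∀ n : ℕ, 1 ≤ n → (w n : ℝ) ≤ m * (n : ℝ) ^ κ := fun n hn => by
    simp only [hw, hg]
    push_cast
    gcongr
    exact Nat.floor_le (by positivity)
  have lim_wΨ : Tendsto (fun n : ℕ => ((w n : ℝ) + 1) * Ψ n) atTop (𝓝 0) := by
    have h := ((lim_Ψ κ).const_mul (m : ℝ)).add lim_Ψ0
    rw [mul_zero, add_zero] at h
    refine squeeze_zero' (Eventually.of_forall fun n => ?_) ?_ h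
    · simp only [hΨ, gapError]; positivity
    · filter_upwards [eventually_ge_atTop 1] with n hn
      have h0 : 0 ≤ Ψ n := by simp only [hΨ, gapError]; positivity
      nlinarith [mul_le_mul_of_nonneg_right (hpow n hn) h0]
  have lim_L : Tendsto (fun n => (L n : ℝ) / n) atTop (𝓝 0) := by
    have h := (tendsto_natCast_rpow_of_neg (p := ε - 1) (by linarith)).const_mul ((m : ℝ) + 2)
    rw [mul_zero] at h
    refine squeeze_zero' (Eventually.of_forall fun n => by positivity) ?_ h
    filter_upwards [eventually_ge_atTop 1] with n hn
    have hn' : (1 : ℝ) ≤ n := by exact_mod_cast hn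
    have hn0 : (0 : ℝ) < n := by linarith
    have h1 : (N n : ℝ) ≤ (n : ℝ) ^ ε + 1 := (Nat.ceil_lt_add_one (by positivity)).le
    have h2 : 1 ≤ (n : ℝ) ^ ε := Real.one_le_rpow hn' hε.le
    have h3 : (n : ℝ) ^ κ ≤ (n : ℝ) ^ ε := Real.rpow_le_rpow_of_exponent_le hn' (by linarith)
    have h4 : (m : ℝ) * (n : ℝ) ^ κ ≤ m * (n : ℝ) ^ ε := by gcongr
    rw [Real.rpow_sub hn0, Real.rpow_one, ← mul_div_assoc]
    gcongr
    simp only [hL]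
    push_cast
    linarith [hpow n hn]
  -- the total error of the recurrence
  set e : ℕ → ℝ := fun n => |τ n| * Ψ n + τ n ^ 2 * (((w n : ℝ) + 1) * Ψ n) +
      |τ n| ^ 3 * (2 * (n : ℝ) ^ α * w n) * (((w n : ℝ) + 2) * (|b ((n : ℝ) ^ α) 0| + Ψ n)) +
      τ n ^ 2 * |β n| * (|τ n| * (2 * (n : ℝ) ^ α * w n)) with he
  -- With |τ| of order n^(-1/2), the four terms of n·e become √n Ψ, (w+1)Ψ, K w(w+2)/√n times a
  -- bounded factor, and K w/√n times a bounded factor.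
  have lim_e : Tendsto (fun n : ℕ => (n : ℝ) * e n) atTop (𝓝 0) := by
    have h := ((((lim_Ψ (1 / 2)).const_mul s₀).add (lim_wΨ.const_mul (s₀ ^ 2))).add
      ((lim_Kw2.mul (lim_b0.abs.add lim_Ψ0)).const_mul (2 * s₀ ^ 3))).add
      ((lim_Kw.mul lim_β.abs).const_mul (2 * s₀ ^ 3))
    simp only [mul_zero, zero_mul, add_zero] at h
    refine h.congr' ?_
    filter_upwards [eventually_ge_atTop 1] with n hn
    have hn0 : (0 : ℝ) < n := by exact_mod_cast hn
    simp only [he]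
    rw [← sq_abs (τ n), hτabs, ← Real.sqrt_eq_rpow]
    have hs := Real.sq_sqrt hn0.le
    set y := √(n : ℝ) with hy
    have hy0 : 0 < y := Real.sqrt_pos.2 hn0
    generalize (n : ℝ) ^ α = K at *
    rw [← hs]
    field_simp
  have lim_f0 : Tendsto (fun n : ℕ => cosExpectation P (X ((n : ℝ) ^ α)) (ρ n) (τ n) φ (N n) (L n))
      atTop (𝓝 (Real.cos φ)) := by
    -- The recurrence starts one window after N; the empty sum at N gives exactly cos φ, and w terms
    -- move the value by at most |τ|·2Kw.
    have h := lim_Kw.const_mul (2 * s₀)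
    rw [mul_zero] at h
    rw [tendsto_iff_norm_sub_tendsto_zero]
    refine squeeze_zero' (Eventually.of_forall fun n => norm_nonneg _) ?_ h
    filter_upwards [eventually_ge_atTop 1] with n hn
    have hn' : (1 : ℝ) ≤ n := by exact_mod_cast hn
    have h1 := hX.abs_cosExpectation_sub_le (Real.one_le_rpow hn' hα.le)
      (hρ n hn 0 (by omega)).integrable (hρ0 n) (hρ1 n) (N := N n) (w := w n) (l := L n) le_rfl
      (τ n) φ
    have e1 : L n - w n = N n := by simp only [hL]; omega
    have e2 : cosExpectation P (X ((n : ℝ) ^ α)) (ρ n) (τ n) φ (N n) (N n) = Real.cos φ := by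
      simp only [cosExpectation, Finset.Ico_self, Finset.sum_empty, mul_zero, zero_add]
      rw [integral_mul_const, hρ1, one_mul]
    rw [e1, e2, abs_sub_comm, hτabs] at h1
    rw [Real.norm_eq_abs]
    refine h1.trans (le_of_eq (by ring))
  have lim_x : Tendsto (fun n => (t / σ) ^ 2 * β n) atTop (𝓝 (t ^ 2 / 2)) := by
    have := lim_β.const_mul ((t / σ) ^ 2)
    convert this using 2
    field_simp
  have ev_β : ∀ᶠ n in atTop, 0 ≤ (t / σ) ^ 2 * β n := by
    filter_upwards [lim_β.eventually (lt_mem_nhds (by positivity : 0 < σ ^ 2 / 2))] with n h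
    positivity
  have lim_q := tendsto_one_sub_div_pow_sub lim_x ev_β lim_L
  have lim_main := lim_f0.mul lim_q
  have hq : ∀ n : ℕ, 1 ≤ n → τ n ^ 2 * β n = (t / σ) ^ 2 * β n / n := fun n hn => by
    simp only [hτ]
    rw [div_pow, mul_pow, Real.sq_sqrt (Nat.cast_nonneg n), div_pow]
    field_simp
  have ev_q : ∀ᶠ n : ℕ in atTop, (t / σ) ^ 2 * β n / n < 1 :=
    (lim_x.div_atTop tendsto_natCast_atTop_atTop).eventually (gt_mem_nhds one_pos)
  have ev_L : ∀ᶠ n in atTop, L n ≤ n := by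
    filter_upwards [lim_L.eventually (gt_mem_nhds one_pos), eventually_ge_atTop 1] with n h hn
    rw [div_lt_one (by positivity)] at h
    exact_mod_cast h.le
  have ev_gN : ∀ᶠ n : ℕ in atTop, 2 * g n ≤ N n := by
    have h1 : Tendsto (fun n : ℕ => (n : ℝ) ^ (ε - κ)) atTop atTop :=
      (tendsto_rpow_atTop (by linarith)).comp (tendsto_natCast_atTop_atTop (R := ℝ))
    filter_upwards [h1.eventually_ge_atTop 2, eventually_ge_atTop 1] with n h hn
    have hn0 : (0 : ℝ) < n := by exact_mod_cast hn
    have h2 : (g n : ℝ) ≤ (n : ℝ) ^ κ := Nat.floor_le (by positivity)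
    have h3 : (n : ℝ) ^ ε ≤ N n := Nat.le_ceil _
    rw [Real.rpow_sub hn0, le_div_iff₀ (by positivity)] at h
    have h4 : (2 : ℝ) * g n ≤ N n := by linarith
    exact_mod_cast h4
  have ev_τ : ∀ᶠ n : ℕ in atTop, |τ n| * (2 * (n : ℝ) ^ α * w n) ≤ 1 := by
    have h := lim_Kw.const_mul (2 * s₀)
    rw [mul_zero] at h
    filter_upwards [h.eventually (gt_mem_nhds one_pos)] with n hn
    rw [hτabs]
    refine le_trans (le_of_eq (by ring)) hn.le
  refine tendsto_of_tendsto_of_dist lim_main (squeeze_zero'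
    (Eventually.of_forall fun n => dist_nonneg) ?_ lim_e)
  filter_upwards [ev_β, ev_q, ev_L, ev_gN, ev_τ, eventually_ge_atTop 1] with n h1 h2 h3 h4 h5 hn
  have hn' : (1 : ℝ) ≤ n := by exact_mod_cast hn
  have hn0 : (0 : ℝ) < n := by linarith
  have hK : 1 ≤ (n : ℝ) ^ α := Real.one_le_rpow hn' hα.le
  have hg1 : 1 ≤ g n := Nat.one_le_floor_iff _ |>.2 (Real.one_le_rpow hn' hκ.le)
  have hw1 : 1 ≤ w n := Nat.mul_pos (by omega) hg1
  have hw1' : (1 : ℝ) ≤ w n := by exact_mod_cast hw1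
  have hR : 1 ≤ c * (n : ℝ) ^ d := by
    have := Real.one_le_rpow hn' hd
    nlinarith
  have hτ1 : |τ n| ≤ 1 := by
    refine le_trans (le_mul_of_one_le_right (abs_nonneg _) ?_) h5
    nlinarith
  have hj : ∀ j ≤ 2 * g n, Real.exp (v * j) * θ ^ (2 * (M + 1) * g n - j) ≤ θ ^ g n := by
    intro j hj
    have a1 : Real.exp (v * j) ≤ Real.exp (2 * v) ^ g n := by
      rw [← Real.exp_nat_mul, Real.exp_le_exp]
      have : (j : ℝ) ≤ 2 * g n := by exact_mod_cast hj
      nlinarith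
    have a2 : θ ^ (2 * (M + 1) * g n - j) ≤ (θ ^ M) ^ g n := by
      rw [← pow_mul]
      refine pow_le_pow_of_le_one hθ0.le hθ1.le ?_
      have : 2 * (M + 1) * g n = M * g n + M * g n + 2 * g n := by ring
      omega
    calc Real.exp (v * j) * θ ^ (2 * (M + 1) * g n - j)
        ≤ Real.exp (2 * v) ^ g n * (θ ^ M) ^ g n := by gcongr
      _ = (Real.exp (2 * v) * θ ^ M) ^ g n := (mul_pow _ _ _).symm
      _ ≤ θ ^ g n := by
        gcongr
        calc Real.exp (2 * v) * θ ^ M ≤ Real.exp (2 * v) * (θ * Real.exp (-(2 * v))) := by gcongr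
          _ = θ := by rw [mul_left_comm, ← Real.exp_add, add_neg_cancel, Real.exp_zero, mul_one]
  have hrec := fun l (hl : L n ≤ l) (hln : l < n) =>
    hX.abs_cosExpectation_succ_sub_le hA hv hθ0 hθ1 hK hR hτ1 (hρ n hn) (hρ0 n) (hρ1 n) hg1
      (h := 2 * (M + 1) * g n) (by nlinarith) hj (w := w n) (by simp only [hw, hm]; ring) h5 h4
      hl hln φ
  have he0 : 0 ≤ e n := by
    have : 0 ≤ Ψ n := by simp only [hΨ, gapError]; positivity
    simp only [he]
    positivity
  have hq1 : |1 - τ n ^ 2 * β n| ≤ 1 := by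
    rw [hq n hn, abs_le]
    have : 0 ≤ (t / σ) ^ 2 * β n / n := by positivity
    constructor <;> linarith
  have := abs_sub_pow_mul_le hq1 he0 h3 hrec
  rw [hq n hn] at this
  rw [dist_comm, Real.dist_eq,
    mul_comm (cosExpectation P (X ((n : ℝ) ^ α)) (ρ n) (τ n) φ (N n) (L n))]
  exact this

end WeakDepCLT

/-! ### Convergence in distribution through cosines -/

namespace WeakDepCLT

variable {Ω : Type*} {mΩ : MeasurableSpace Ω}

section ConvergenceInDistribution

variable {Q : ℕ → Measure Ω} [∀ n, IsProbabilityMeasure (Q n)] {Z Z' : ℕ → Ω → ℝ}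

omit [∀ n, IsProbabilityMeasure (Q n)] in
lemma aestronglyMeasurable_cos {μ : Measure Ω} {Y : Ω → ℝ} (hY : AEMeasurable Y μ) (t φ : ℝ) :
    AEStronglyMeasurable (fun ω => Real.cos (t * Y ω + φ)) μ :=
  (Real.measurable_cos.comp_aemeasurable ((hY.const_mul t).add_const φ)).aestronglyMeasurable

omit [∀ n, IsProbabilityMeasure (Q n)] in
lemma integrable_cos {μ : Measure Ω} [IsFiniteMeasure μ] {Y : Ω → ℝ} (hY : AEMeasurable Y μ)
    (t φ : ℝ) : Integrable (fun ω => Real.cos (t * Y ω + φ)) μ :=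
  integrable_of_abs_le (aestronglyMeasurable_cos hY t φ)
    (Eventually.of_forall fun _ => Real.abs_cos_le_one _)

lemma charFun_map_eq_cos {μ : Measure Ω} [IsFiniteMeasure μ] {Y : Ω → ℝ} (hY : AEMeasurable Y μ)
    (t : ℝ) : charFun (μ.map Y) t = ((∫ ω, Real.cos (t * Y ω + 0) ∂μ : ℝ) : ℂ) +
      ((∫ ω, Real.cos (t * Y ω + -(Real.pi / 2)) ∂μ : ℝ) : ℂ) * Complex.I := by
  rw [charFun_apply_real, integral_map hY (by fun_prop), ← integral_complex_ofReal,
    ← integral_complex_ofReal, ← integral_mul_const, ← integral_add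
      (integrable_cos hY t 0).ofReal ((integrable_cos hY t _).ofReal.mul_const _)]
  refine integral_congr_ae (Eventually.of_forall fun ω => ?_)
  simp only
  rw [add_zero, ← sub_eq_add_neg, Real.cos_sub_pi_div_two, ← Complex.ofReal_mul,
    Complex.exp_mul_I, Complex.ofReal_cos, Complex.ofReal_sin]

/-- Convergence in distribution to the standard normal law, in terms of cosines. -/
theorem tendstoInDistribution_gaussian_of_cos (hZ : ∀ n, AEMeasurable (Z n) (Q n))
    (h : ∀ t φ : ℝ, Tendsto (fun n => ∫ ω, Real.cos (t * Z n ω + φ) ∂(Q n)) atTop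
      (𝓝 (Real.cos φ * Real.exp (-(t ^ 2 / 2))))) :
    TendstoInDistribution Z atTop (id : ℝ → ℝ) Q (gaussianReal 0 1) := by
  refine ⟨hZ, aemeasurable_id, ProbabilityMeasure.tendsto_iff_tendsto_charFun.2 fun t => ?_⟩
  have h1 := (Complex.continuous_ofReal.tendsto _).comp (h t 0)
  have h2 := ((Complex.continuous_ofReal.tendsto _).comp (h t (-(Real.pi / 2)))).mul_const
    Complex.I
  have h3 := h1.add h2
  have e : charFun ((gaussianReal 0 1).map id) t =
      ((Real.cos 0 * Real.exp (-(t ^ 2 / 2)) : ℝ) : ℂ) +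
      ((Real.cos (-(Real.pi / 2)) * Real.exp (-(t ^ 2 / 2)) : ℝ) : ℂ) * Complex.I := by
    rw [Measure.map_id, charFun_gaussianReal, Real.cos_neg, Real.cos_pi_div_two, Real.cos_zero]
    push_cast
    simp
  simp only [ProbabilityMeasure.coe_mk]
  rw [e]
  refine h3.congr fun n => ?_
  rw [charFun_map_eq_cos (hZ n)]
  rfl

/-- The cosine is Lipschitz, so an L¹-small perturbation does not change the limit. -/
lemma tendsto_cos_of_tendsto_integral_abs_sub (hZ : ∀ n, AEMeasurable (Z n) (Q n))
    (hZ' : ∀ n, AEMeasurable (Z' n) (Q n)) {e : ℕ → ℝ} (he : Tendsto e atTop (𝓝 0))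
    (hi : ∀ᶠ n in atTop, Integrable (fun ω => Z n ω - Z' n ω) (Q n) ∧
      ∫ ω, |Z n ω - Z' n ω| ∂(Q n) ≤ e n) {t φ y : ℝ}
    (h : Tendsto (fun n => ∫ ω, Real.cos (t * Z' n ω + φ) ∂(Q n)) atTop (𝓝 y)) :
    Tendsto (fun n => ∫ ω, Real.cos (t * Z n ω + φ) ∂(Q n)) atTop (𝓝 y) := by
  have h0 := he.const_mul |t|
  rw [mul_zero] at h0
  refine tendsto_of_tendsto_of_dist h (squeeze_zero' (Eventually.of_forall fun n => dist_nonneg)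
    ?_ h0)
  filter_upwards [hi] with n hn
  rw [Real.dist_eq, ← integral_sub (integrable_cos (hZ' n) t φ) (integrable_cos (hZ n) t φ)]
  refine abs_integral_le_integral_abs.trans ?_
  calc _ ≤ ∫ ω, |t| * |Z n ω - Z' n ω| ∂(Q n) := by
        refine integral_mono_of_nonneg (Eventually.of_forall fun ω => abs_nonneg _)
          (hn.1.abs.const_mul _) (Eventually.of_forall fun ω => ?_)
        refine (Real.abs_cos_sub_cos_le _ _).trans (le_of_eq ?_)
        have e1 : t * Z' n ω + φ - (t * Z n ω + φ) = -(t * (Z n ω - Z' n ω)) := by ring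
        rw [e1, abs_neg, abs_mul]
    _ = |t| * ∫ ω, |Z n ω - Z' n ω| ∂(Q n) := integral_const_mul _ _
    _ ≤ _ := by gcongr; exact hn.2

end ConvergenceInDistribution

/-! ### Densities as test variables -/

section Density

variable {P Q : Measure Ω} {ρ : Ω → ℝ}

lemma HasDensity.integral_eq (h : HasDensity Q P ρ) (f : Ω → ℝ) :
    ∫ ω, f ω ∂Q = ∫ ω, ρ ω * f ω ∂P := by
  obtain ⟨h1, h2, h3⟩ := h
  rw [h3, integral_withDensity_eq_integral_toReal_smul h1.ennreal_ofReal (by simp)]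
  simp [ENNReal.toReal_ofReal (h2 _)]

lemma HasDensity.absolutelyContinuous (h : HasDensity Q P ρ) : Q ≪ P := by
  rw [h.2.2]
  exact withDensity_absolutelyContinuous _ _

lemma HasDensity.integral_density [IsProbabilityMeasure Q] (h : HasDensity Q P ρ) :
    ∫ ω, ρ ω ∂P = 1 := by
  have := h.integral_eq (fun _ => 1)
  simpa using this.symm

lemma HasDensity.integrable (h : HasDensity Q P ρ) {B : ℝ} (hB : ∀ᵐ ω ∂P, ρ ω ≤ B) {f : Ω → ℝ}
    (hf : Integrable f P) : Integrable f Q := by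
  have h1 : Q ≤ ENNReal.ofReal B • P := by
    rw [h.2.2, ← withDensity_const]
    refine withDensity_mono ?_
    filter_upwards [hB] with ω hω
    exact ENNReal.ofReal_le_ofReal hω
  exact (hf.smul_measure ENNReal.ofReal_ne_top).mono_measure h1

/-- The approximant r of the density need not be bounded. Clipping it to [-B, B], with B = Cn^u,
keeps it measurable and brings it no further from the density, which already lies in that interval.
-/
lemma approximable_of_densityApprox [IsProbabilityMeasure P] {C u θ : ℝ}
    {F : ℕ → Filtration ℕ mΩ} {ρ : ℕ → Ω → ℝ} (hC : 1 ≤ C) (hu : 0 < u) (hθ0 : 0 < θ)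
    (hρm : ∀ n, Measurable (ρ n)) (hρ0 : ∀ n ω, 0 ≤ ρ n ω) (D1 : DensityBound P C u ρ)
    (D2 : DensityApprox P C u θ F ρ) {n k : ℕ} (hn : 1 ≤ n) (hk : k < n) :
    Approximable P (F n k) (ρ n) (3 * C ^ 2 * (n : ℝ) ^ (2 * u))
      (3 * C ^ 2 * (n : ℝ) ^ (2 * u) * θ ^ k) := by
  obtain ⟨r, hr, hrp⟩ := D2 n k hk
  have hn' : (1 : ℝ) ≤ n := by exact_mod_cast hn
  have hnu : 1 ≤ (n : ℝ) ^ u := Real.one_le_rpow hn' hu.le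
  have e2 : (n : ℝ) ^ (2 * u) = (n : ℝ) ^ u * (n : ℝ) ^ u := by
    rw [← Real.rpow_add (by linarith)]; congr 1; ring
  set B := C * (n : ℝ) ^ u with hB
  have hB1 : 1 ≤ B := by nlinarith
  have hBB : 3 * C ^ 2 * (n : ℝ) ^ (2 * u) = 3 * (B * B) := by rw [e2, hB]; ring
  rw [hBB]
  have hBle : B ≤ 3 * (B * B) := by nlinarith
  have hρB : ∀ᵐ ω ∂P, |ρ n ω| ≤ B := by
    filter_upwards [D1 n hn] with ω h
    rwa [abs_of_nonneg (hρ0 n ω)]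
  have hr' : Measurable r := hr.mono ((F n).le k) le_rfl
  have hTb : ∀ ω, |max (-B) (min (r ω) B)| ≤ B := fun ω =>
    abs_le.2 ⟨le_max_left _ _, max_le (by linarith) (min_le_right _ _)⟩
  have hTm : Measurable[F n k] (fun ω => max (-B) (min (r ω) B)) :=
    measurable_const.max (hr.min measurable_const)
  refine ⟨hρm n, hρB.mono fun ω h => h.trans hBle, _, hTm,
    Eventually.of_forall fun ω => (hTb ω).trans hBle, ?_⟩
  have hθk : 0 ≤ θ ^ k := by positivity
  have hS : MeasurableSet {ω | |ρ n ω - r ω| < θ ^ k} :=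
    measurableSet_lt ((hρm n).sub hr').abs measurable_const
  have hcon : ∀ᵐ ω ∂P, |ρ n ω - max (-B) (min (r ω) B)| ≤ |ρ n ω - r ω| := by
    filter_upwards [hρB] with ω h
    have e : ρ n ω = max (-B) (min (ρ n ω) B) := by
      rw [min_eq_left (abs_le.1 h).2, max_eq_right (abs_le.1 h).1]
    conv_lhs => rw [e]
    refine (abs_max_sub_max_le_max _ _ _ _).trans (max_le (by simp) ?_)
    exact (abs_min_sub_min_le_max _ _ _ _).trans (max_le le_rfl (by simp))
  have key := integral_abs_le_of_le_on (P := P)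
    (Z := fun ω => ρ n ω - max (-B) (min (r ω) B)) (D := 2 * B) hS hθk (by
      filter_upwards [hρB] with ω h
      exact (abs_sub _ _).trans (by linarith [hTb ω])) (by
      filter_upwards [hcon] with ω h hω
      exact h.trans (le_of_lt hω))
  have hc : {ω | |ρ n ω - r ω| < θ ^ k}ᶜ = {ω | θ ^ k ≤ |ρ n ω - r ω|} := by
    ext ω; simp
  rw [hc] at key
  calc _ ≤ θ ^ k + 2 * B * (B * θ ^ k) := key.trans (by gcongr)
    _ = (1 + 2 * (B * B)) * θ ^ k := by ring
    _ ≤ 3 * (B * B) * θ ^ k := by gcongr; nlinarith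

end Density

/-! ### Removal of the truncation -/

section CLT

variable {P : Measure Ω} [IsProbabilityMeasure P] {C u θ s : ℝ}
  {ξ : ℕ → Ω → ℝ} {ξK : ℝ → ℕ → Ω → ℝ} {F : ℕ → Filtration ℕ mΩ} {b : ℝ → ℕ → ℝ}

omit [IsProbabilityMeasure P] in
lemma integral_abs_sum_div_le {Q : Measure Ω} {f : ℕ → Ω → ℝ} {S : Finset ℕ} {E r : ℝ}
    (hf : ∀ l ∈ S, Integrable (f l) Q) (hE : ∀ l ∈ S, ∫ ω, |f l ω| ∂Q ≤ E) (hr : 0 ≤ r) :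
    ∫ ω, |(∑ l ∈ S, f l ω) / r| ∂Q ≤ S.card * E / r := by
  calc ∫ ω, |(∑ l ∈ S, f l ω) / r| ∂Q ≤ ∫ ω, (∑ l ∈ S, |f l ω|) / r ∂Q := by
        refine integral_mono_of_nonneg (Eventually.of_forall fun ω => abs_nonneg _)
          ((integrable_finsetSum _ fun l hl => (hf l hl).abs).div_const _)
          (Eventually.of_forall fun ω => ?_)
        simp only
        rw [abs_div, abs_of_nonneg hr]
        gcongr
        exact Finset.abs_sum_le_sum_abs _ _
    _ = (∑ l ∈ S, ∫ ω, |f l ω| ∂Q) / r := by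
        rw [integral_div, integral_finsetSum _ fun l hl => (hf l hl).abs]
    _ ≤ _ := by
        gcongr
        refine (Finset.sum_le_sum hE).trans (le_of_eq ?_)
        rw [Finset.sum_const, nsmul_eq_mul]

lemma Truncation.integrable_xi (H1 : Truncation P C s ξ ξK) (l : ℕ) : Integrable (ξ l) P :=
  (H1.memLp l).integrable one_le_two

lemma Truncation.integrable_trunc (H1 : Truncation P C s ξ ξK) {K : ℝ} (hK : 1 ≤ K) (l : ℕ) :
    Integrable (ξK K l) P := (H1.memLp_trunc hK l).integrable one_le_two

lemma Truncation.integrable_centered (H1 : Truncation P C s ξ ξK) (l : ℕ) :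
    Integrable (centered P (ξ l)) P := (H1.integrable_xi l).sub (integrable_const _)

lemma Truncation.aemeasurable_sum (H1 : Truncation P C s ξ ξK) (S : Finset ℕ) (r : ℝ) :
    AEMeasurable (fun ω => (∑ l ∈ S, centered P (ξ l) ω) / r) P :=
  (integrable_finsetSum S fun l _ => H1.integrable_centered l).aemeasurable.div_const r

omit [IsProbabilityMeasure P] in
-- The centring is relative to P even when integrating under Q, so an L¹ bound is needed under both
-- measures.
lemma integral_abs_centered_sub_le {Q : Measure Ω} [IsProbabilityMeasure Q] {f g : Ω → ℝ}
    {E : ℝ} (hf : Integrable f P) (hg : Integrable g P) (hfQ : Integrable f Q)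
    (hgQ : Integrable g Q) (hE : ∫ ω, |f ω - g ω| ∂P ≤ E) (hEQ : ∫ ω, |f ω - g ω| ∂Q ≤ E) :
    ∫ ω, |centered P f ω - centered P g ω| ∂Q ≤ 2 * E := by
  have h1 : |∫ ω, f ω ∂P - ∫ ω, g ω ∂P| ≤ E := by
    rw [← integral_sub hf hg]
    exact abs_integral_le_integral_abs.trans hE
  have i1 : Integrable (fun ω => |f ω - g ω|) Q := (hfQ.sub hgQ).abs
  calc ∫ ω, |centered P f ω - centered P g ω| ∂Q ≤ ∫ ω, (|f ω - g ω| + E) ∂Q := by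
        refine integral_mono_of_nonneg (Eventually.of_forall fun ω => abs_nonneg _)
          (i1.add (integrable_const _)) (Eventually.of_forall fun ω => ?_)
        have e : centered P f ω - centered P g ω =
            (f ω - g ω) - (∫ ω, f ω ∂P - ∫ ω, g ω ∂P) := by
          simp only [centered]; ring
        simp only
        rw [e]
        exact (abs_sub _ _).trans (by linarith)
    _ = ∫ ω, |f ω - g ω| ∂Q + E := by
        rw [integral_add i1 (integrable_const _)]; simp
    _ ≤ _ := by linarith

/-- The central limit theorem under the densities `ρ n`, in terms of cosines. -/
theorem tendsto_integral_cos_of_density {A v D δ σ ε : ℝ}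
    (hX : Mixing P A v θ (fun K l => centered P (ξK K l)) F b)
    (hA : 1 ≤ A) (hv : 0 < v) (hC : 1 ≤ C) (hu : 0 < u) (hθ0 : 0 < θ) (hθ1 : θ < 1) (hs : 2 < s)
    (H1 : Truncation P C s ξ ξK) {σj : ℕ → ℝ} (hδ : 0 < δ)
    (hb : ∀ K : ℝ, 1 ≤ K → ∀ j, |b K j - σj j| ≤ D * K ^ (-δ)) (hσj : Summable σj)
    (hσ : 0 < σ) (hσ2 : σ ^ 2 = σj 0 + 2 * ∑' j : ℕ, σj (j + 1))
    (hε : 0 < ε) (hεs : (1 + ε) / s + ε < 1 / 2)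
    {Pn : ℕ → Measure Ω} [∀ n, IsProbabilityMeasure (Pn n)] {ρ : ℕ → Ω → ℝ}
    (hρ : ∀ n, HasDensity (Pn n) P (ρ n)) (D1 : DensityBound P C u ρ)
    (D2 : DensityApprox P C u θ F ρ) (D3 : DensityTruncation Pn C s ε ξ ξK) (t φ : ℝ) :
    Tendsto (fun n : ℕ => ∫ ω, Real.cos (t * ((∑ l ∈ Finset.Ico ⌈(n : ℝ) ^ ε⌉₊ n,
      centered P (ξ l) ω) / (σ * √(n : ℝ))) + φ) ∂(Pn n)) atTop
      (𝓝 (Real.cos φ * Real.exp (-(t ^ 2 / 2)))) := by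
  set α := (1 + ε) / s with hαd
  have hα : 0 < α := by positivity
  have hcos := hX.tendsto_cosExpectation hA hv hθ0 hθ1 hδ hb hσj hσ hσ2 hα hε hεs
    (c := 3 * C ^ 2) (d := 2 * u) (by nlinarith) (by positivity)
    (fun n hn k hk => approximable_of_densityApprox hC hu hθ0 (fun n => (hρ n).1)
      (fun n => (hρ n).2.1) D1 D2 hn hk)
    (fun n => (hρ n).2.1) (fun n => (hρ n).integral_density) t φ
  have hK : ∀ n : ℕ, 1 ≤ n → 1 ≤ (n : ℝ) ^ α := fun n hn =>
    Real.one_le_rpow (by exact_mod_cast hn) hα.le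
  -- At n = 0 the level is 0, below the range K ≥ 1 where the truncations are known to be
  -- measurable, hence the default 0.
  set Z' : ℕ → Ω → ℝ := fun n ω => (∑ l ∈ Finset.Ico ⌈(n : ℝ) ^ ε⌉₊ n,
    (if 1 ≤ n then centered P (ξK ((n : ℝ) ^ α) l) else 0) ω) / (σ * √(n : ℝ)) with hZ'
  have hZ'm : ∀ n, AEMeasurable (Z' n) (Pn n) := fun n => by
    refine ((Finset.measurable_fun_sum _ fun l _ => ?_).div_const _).aemeasurable
    split_ifs with hn
    · exact hX.measurable _ (hK n hn) l
    · exact measurable_const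
  refine tendsto_cos_of_tendsto_integral_abs_sub (Z' := Z')
    -- At most n errors of size 2CK^(1-s), divided by σ√n; the exponent is simplified by αs = 1 + ε
    -- and is negative because α < 1/2.
    (e := fun n : ℕ => 2 * C / σ * (n : ℝ) ^ (α + 1 / 2 - (1 + ε)))
    (fun n => (H1.aemeasurable_sum _ _).mono_ac (hρ n).absolutelyContinuous) hZ'm ?_ ?_ ?_
  · simpa using (tendsto_natCast_rpow_of_neg (p := α + 1 / 2 - (1 + ε))
      (by linarith)).const_mul (2 * C / σ)
  · filter_upwards [eventually_ge_atTop 1] with n hn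
    have hn0 : (0 : ℝ) < n := by exact_mod_cast hn
    set K := (n : ℝ) ^ α with hKd
    have hKn := hK n hn
    have iQ : ∀ {f : Ω → ℝ}, Integrable f P → Integrable f (Pn n) :=
      fun hf => (hρ n).integrable (D1 n hn) hf
    have hdiff : ∀ ω, (∑ l ∈ Finset.Ico ⌈(n : ℝ) ^ ε⌉₊ n, centered P (ξ l) ω) /
        (σ * √(n : ℝ)) - Z' n ω = (∑ l ∈ Finset.Ico ⌈(n : ℝ) ^ ε⌉₊ n,
          (centered P (ξ l) ω - centered P (ξK K l) ω)) / (σ * √(n : ℝ)) := fun ω => by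
      simp only [hZ', if_pos hn]
      rw [← sub_div, Finset.sum_sub_distrib]
    have hint : ∀ l, Integrable (fun ω => centered P (ξ l) ω - centered P (ξK K l) ω) (Pn n) :=
      fun l => iQ ((H1.integrable_centered l).sub (hX.integrable hKn l))
    simp_rw [hdiff]
    refine ⟨(integrable_finsetSum _ fun l _ => hint l).div_const _, ?_⟩
    have hE : ∀ l ∈ Finset.Ico ⌈(n : ℝ) ^ ε⌉₊ n,
        ∫ ω, |centered P (ξ l) ω - centered P (ξK K l) ω| ∂(Pn n) ≤ 2 * (C * K ^ (1 - s)) := by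
      intro l hl
      obtain ⟨hl1, hl2⟩ := Finset.mem_Ico.1 hl
      refine integral_abs_centered_sub_le (H1.integrable_xi l) (H1.integrable_trunc hKn l)
        (iQ (H1.integrable_xi l)) (iQ (H1.integrable_trunc hKn l)) ?_
        (D3 n hn l (Nat.ceil_le.1 hl1) hl2.le)
      simp_rw [abs_sub_comm (ξ l _)]
      exact H1.l1_error K hKn l
    refine (integral_abs_sum_div_le (fun l _ => hint l) hE (by positivity)).trans ?_
    have hcard : ((Finset.Ico ⌈(n : ℝ) ^ ε⌉₊ n).card : ℝ) ≤ n := by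
      rw [Nat.card_Ico]
      exact_mod_cast Nat.sub_le _ _
    calc _ ≤ (n : ℝ) * (2 * (C * K ^ (1 - s))) / (σ * √(n : ℝ)) := by gcongr
      _ = 2 * C / σ * ((n : ℝ) ^ (1 : ℝ) * K ^ (1 - s) / √(n : ℝ)) := by
        rw [Real.rpow_one]; field_simp
      _ = _ := by
        rw [hKd, ← Real.rpow_mul hn0.le, Real.sqrt_eq_rpow, ← Real.rpow_add hn0,
          ← Real.rpow_sub hn0]
        congr 2
        have : α * s = 1 + ε := by rw [hαd]; field_simp
        linear_combination -this
  · refine hcos.congr' ?_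
    filter_upwards [eventually_ge_atTop 1] with n hn
    rw [(hρ n).integral_eq, Mixing.cosExpectation]
    refine integral_congr_ae (Eventually.of_forall fun ω => ?_)
    simp only [hZ', if_pos hn]
    congr 2
    ring

/-- Under P the variables are uniformly bounded in L¹, so the initial n^ε terms contribute
O(n^(ε-1/2)). -/
lemma tendsto_integral_cos_of_density_one {σ ε : ℝ} (hC : 0 < C)
    (H1 : Truncation P C s ξ ξK) (hσ : 0 < σ) (hε : 0 < ε) (hε2 : ε < 1 / 2) {t φ y : ℝ}
    (h : Tendsto (fun n : ℕ => ∫ ω, Real.cos (t * ((∑ l ∈ Finset.Ico ⌈(n : ℝ) ^ ε⌉₊ n,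
      centered P (ξ l) ω) / (σ * √(n : ℝ))) + φ) ∂P) atTop (𝓝 y)) :
    Tendsto (fun n : ℕ => ∫ ω, Real.cos (t * ((∑ l ∈ Finset.range n,
      centered P (ξ l) ω) / (σ * √(n : ℝ))) + φ) ∂P) atTop (𝓝 y) := by
  refine tendsto_cos_of_tendsto_integral_abs_sub (Q := fun _ => P)
    (e := fun n : ℕ => 4 * (C + 1) / σ * (n : ℝ) ^ (ε - 1 / 2))
    (fun n => H1.aemeasurable_sum _ _) (fun n => H1.aemeasurable_sum _ _) ?_ ?_ h
  · simpa using (tendsto_natCast_rpow_of_neg (p := ε - 1 / 2) (by linarith)).const_mul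
      (4 * (C + 1) / σ)
  · filter_upwards [eventually_ge_atTop 1] with n hn
    have hn1 : (1 : ℝ) ≤ n := by exact_mod_cast hn
    have hn0 : (0 : ℝ) < n := by linarith
    have hNn : ⌈(n : ℝ) ^ ε⌉₊ ≤ n := by
      rw [Nat.ceil_le]
      calc (n : ℝ) ^ ε ≤ (n : ℝ) ^ (1 : ℝ) := Real.rpow_le_rpow_of_exponent_le hn1 (by linarith)
        _ = n := Real.rpow_one _
    have hdiff : ∀ ω, (∑ l ∈ Finset.range n, centered P (ξ l) ω) / (σ * √(n : ℝ)) -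
        (∑ l ∈ Finset.Ico ⌈(n : ℝ) ^ ε⌉₊ n, centered P (ξ l) ω) / (σ * √(n : ℝ)) =
        (∑ l ∈ Finset.range ⌈(n : ℝ) ^ ε⌉₊, centered P (ξ l) ω) / (σ * √(n : ℝ)) := fun ω => by
      rw [← sub_div, Finset.sum_Ico_eq_sub _ hNn]
      congr 1; ring
    simp_rw [hdiff]
    refine ⟨(integrable_finsetSum _ fun l _ => H1.integrable_centered l).div_const _, ?_⟩
    have hE : ∀ l ∈ Finset.range ⌈(n : ℝ) ^ ε⌉₊, ∫ ω, |centered P (ξ l) ω| ∂P ≤ 2 * (C + 1) := by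
      intro l _
      have h1 : ∫ ω, |ξ l ω| ∂P ≤ C + 1 := by
        have a1 := H1.l1_error 1 le_rfl l
        rw [Real.one_rpow, mul_one] at a1
        have i1 : Integrable (fun ω => |ξK 1 l ω - ξ l ω|) P :=
          ((H1.integrable_trunc le_rfl l).sub (H1.integrable_xi l)).abs
        calc ∫ ω, |ξ l ω| ∂P ≤ ∫ ω, (|ξK 1 l ω - ξ l ω| + 1) ∂P := by
              refine integral_mono_ae (H1.integrable_xi l).abs (i1.add (integrable_const _)) ?_
              filter_upwards [H1.bounded 1 le_rfl l] with ω hω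
              have := abs_sub_abs_le_abs_sub (ξ l ω) (ξK 1 l ω)
              rw [abs_sub_comm] at this
              linarith
          _ = ∫ ω, |ξK 1 l ω - ξ l ω| ∂P + 1 := by
              rw [integral_add i1 (integrable_const _)]; simp
          _ ≤ _ := by linarith
      have h2 := integral_abs_centered_sub_le (P := P) (Q := P) (f := ξ l) (g := fun _ => 0)
        (H1.integrable_xi l) (integrable_const _) (H1.integrable_xi l) (integrable_const _)
        (by simpa using h1) (by simpa using h1)
      simpa [centered] using h2
    refine (integral_abs_sum_div_le (fun l _ => H1.integrable_centered l) hE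
      (by positivity)).trans ?_
    rw [Finset.card_range]
    have h1 : 1 ≤ (n : ℝ) ^ ε := Real.one_le_rpow hn1 hε.le
    have h2 : (⌈(n : ℝ) ^ ε⌉₊ : ℝ) ≤ 2 * (n : ℝ) ^ ε := by
      have := (Nat.ceil_lt_add_one (by positivity : 0 ≤ (n : ℝ) ^ ε)).le
      linarith
    calc _ ≤ 2 * (n : ℝ) ^ ε * (2 * (C + 1)) / (σ * √(n : ℝ)) := by gcongr
      _ = 4 * (C + 1) / σ * ((n : ℝ) ^ ε / √(n : ℝ)) := by field_simp; ring
      _ = _ := by rw [Real.sqrt_eq_rpow, ← Real.rpow_sub hn0]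

omit [IsProbabilityMeasure P] in
lemma Truncation.mono {C' : ℝ} (H1 : Truncation P C s ξ ξK) (h : C ≤ C') :
    Truncation P C' s ξ ξK where
  memLp := H1.memLp
  measurable := H1.measurable
  bounded := H1.bounded
  l1_error K hK l := (H1.l1_error K hK l).trans (by gcongr)
  l2_error K hK l := (H1.l2_error K hK l).trans (by gcongr)

end CLT

end WeakDepCLT

/-! ### Assembly -/

theorem mainTheorem4 {Ω : Type*} {mΩ : MeasurableSpace Ω} (P : Measure Ω) [IsProbabilityMeasure P]
    (C u θ s : ℝ) (hC : 0 < C) (hu : 0 < u) (hθ0 : 0 < θ) (hθ1 : θ < 1) (hs : 2 < s)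
    (ξ : ℕ → Ω → ℝ) (ξK : ℝ → ℕ → Ω → ℝ) (F : ℕ → Filtration ℕ mΩ)
    (G : ℕ → ℝ → ℕ → ℕ → Set Ω) (b : ℝ → ℕ → ℝ)
    (H1 : WeakDepCLT.Truncation P C s ξ ξK)
    (H2 : WeakDepCLT.AdaptedApprox P C u θ ξK F)
    (hG : WeakDepCLT.GoodEvents P C θ G)
    (H3 : WeakDepCLT.CondMeanDecay P C u θ ξK F G)
    (H4 : WeakDepCLT.CondCovDecay P C u θ ξK F G b) :
    ∃ σj : ℕ → ℝ,
      -- the variance is well defined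
      (∀ j, Tendsto (fun K => b K j) atTop (𝓝 (σj j))) ∧ Summable σj ∧
      0 ≤ σj 0 + 2 * ∑' j : ℕ, σj (j + 1) ∧
      ∀ σ : ℝ, 0 < σ → σ ^ 2 = σj 0 + 2 * ∑' j : ℕ, σj (j + 1) →
        -- (a)
        TendstoInDistribution
          (fun (n : ℕ) ω =>
            (∑ l ∈ Finset.range n, WeakDepCLT.centered P (ξ l) ω) / (σ * √(n : ℝ)))
          atTop (id : ℝ → ℝ) (fun _ => P) (gaussianReal 0 1) ∧
        -- (b)
        ∀ ε : ℝ, 0 < ε → (1 + ε) / s + ε < 1 / 2 →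
          ∀ (Pn : ℕ → Measure Ω) [∀ n, IsProbabilityMeasure (Pn n)] (ρ : ℕ → Ω → ℝ),
            (∀ n, WeakDepCLT.HasDensity (Pn n) P (ρ n)) →
            WeakDepCLT.DensityBound P C u ρ →
            WeakDepCLT.DensityApprox P C u θ F ρ →
            WeakDepCLT.DensityTruncation Pn C s ε ξ ξK →
            TendstoInDistribution
              (fun (n : ℕ) ω =>
                (∑ l ∈ Finset.Ico ⌈(n : ℝ) ^ ε⌉₊ n, WeakDepCLT.centered P (ξ l) ω) /
                  (σ * √(n : ℝ)))
              atTop (id : ℝ → ℝ) Pn (gaussianReal 0 1) := by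
  have hX := WeakDepCLT.mixing_of_hypotheses hC hu hθ0 hθ1 H1 H2 hG H3 H4
  have hA : 1 ≤ 1 + 9 * C := by linarith
  have hv : 0 < u + 2 := by linarith
  have hδ : 0 < (s - 2) / 2 := by linarith
  obtain ⟨c, μ, -, hμ, hbμ⟩ := hX.exists_abs_covLimit_le (by linarith) hv hθ0 hθ1
  have hbD : ∀ K K' : ℝ, 1 ≤ K → K ≤ K' → ∀ j,
      |b K j - b K' j| ≤ (12 * C + 2) * K ^ (-((s - 2) / 2)) := fun K K' hK hKK j =>
    -- The truncation error of the covariances is uniform in k, so it survives the limit k → ∞ that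
    -- defines `b`.
    le_of_tendsto' (((hX.tendsto_integral_mul hθ0 hθ1 hK j).sub
      (hX.tendsto_integral_mul hθ0 hθ1 (hK.trans hKK) j)).abs)
      fun k => H1.abs_integral_mul_sub_le hC hs hK hKK k (k + j)
  obtain ⟨σj, hlim, hbσ, hsum⟩ := WeakDepCLT.exists_covLimit hδ hμ hv hbD hbμ
  refine ⟨σj, hlim, hsum, WeakDepCLT.nonneg_of_covSum_nonneg hsum fun m => ?_,
    fun σ hσ hσ2 => ⟨?_, ?_⟩⟩
  · refine ge_of_tendsto (tendsto_finsetSum _ fun i _ => tendsto_finsetSum _ fun j _ => hlim _) ?_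
    filter_upwards [eventually_ge_atTop 1] with K hK
    exact hX.covSum_nonneg hθ0 hθ1 hK m
  · have h2s : 1 / s < 1 / 2 := one_div_lt_one_div_of_lt two_pos hs
    -- Since ε/s ≤ ε, this gives (1 + ε)/s + ε ≤ 1/s + 2ε < 1/2.
    set ε := (1 / 2 - 1 / s) / 4 with hεd
    have hε : 0 < ε := by rw [hεd]; linarith
    have hεs : ε / s ≤ ε := div_le_self hε.le (by linarith)
    have hε1 : (1 + ε) / s + ε < 1 / 2 := by rw [add_div]; linarith
    have hs0 : 0 < 1 / s := by positivity
    -- Raising C to at least 1 lets the constant density 1 satisfy (D1).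
    have H1' := H1.mono (le_max_left C 1)
    refine WeakDepCLT.tendstoInDistribution_gaussian_of_cos
      (fun n => H1.aemeasurable_sum _ _) fun t φ => ?_
    refine WeakDepCLT.tendsto_integral_cos_of_density_one hC H1 hσ hε (by linarith)
      (WeakDepCLT.tendsto_integral_cos_of_density (ρ := fun _ _ => 1) hX hA hv
        (le_max_right C 1) hu hθ0 hθ1 hs H1' hδ hbσ hsum hσ hσ2 hε hε1 ?_ ?_ ?_ ?_ t φ)
    · exact fun _ => ⟨measurable_const, fun _ => zero_le_one, by simp⟩
    · refine fun n hn => Eventually.of_forall fun ω => ?_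
      exact one_le_mul_of_one_le_of_one_le (le_max_right C 1)
        (Real.one_le_rpow (by exact_mod_cast hn) hu.le)
    · refine fun n k _ => ⟨fun _ => 1, measurable_const, ?_⟩
      have : {ω : Ω | θ ^ k ≤ |(1 : ℝ) - 1|} = ∅ := by
        ext ω
        simp [pow_pos hθ0 k]
      rw [this, measureReal_empty]
      positivity
    · intro n hn l _ _
      simp_rw [abs_sub_comm (ξ l _)]
      exact H1'.l1_error _ (Real.one_le_rpow (by exact_mod_cast hn) (by positivity)) l
  · intro ε hε hεs Pn _ ρ hρ D1 D2 D3
    have hCC : C ≤ max C 1 := le_max_left C 1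
    refine WeakDepCLT.tendstoInDistribution_gaussian_of_cos
      (fun n => (H1.aemeasurable_sum _ _).mono_ac (hρ n).absolutelyContinuous) fun t φ => ?_
    refine WeakDepCLT.tendsto_integral_cos_of_density hX hA hv
        (le_max_right C 1) hu hθ0 hθ1 hs (H1.mono hCC) hδ hbσ hsum hσ hσ2 hε hεs hρ ?_ ?_ ?_ t φ
    · exact fun n hn => (D1 n hn).mono fun ω h => h.trans (by gcongr)
    · intro n k hk
      obtain ⟨r, hr, hrp⟩ := D2 n k hk
      exact ⟨r, hr, hrp.trans (by gcongr)⟩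
    · intro n hn l h1 h2
      refine (D3 n hn l h1 h2).trans ?_
      have : 0 ≤ WeakDepCLT.level s ε n := by unfold WeakDepCLT.level; positivity
      gcongr
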